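/- Let $m\ge 2$, let $\mathcal X$ (non-empty) and $\mathcal Y$ be finite alphabets; logarithms are to base 2. **Setting.** Alice holds $A^k=(A_1,\dots,A_k)$ with $A_i=(A_{i,1},\dots,A_{i,m})\in\{0,1\}^m$ and Bob holds $B^k=(B_1,\dots,B_k)\in\{1,\dots,m\}^k$, where $(A^k,B^k)$ is uniformly distributed on $(\{0,1\}^m)^k\times\{1,\dots,m\}^k$. Bob wishes to compute $G^k=(A_{1,B_1},\dots,A_{k,B_k})$; Alice's function $F^k$ is the constant $0$. In an acceptable $(n,k)$-protocol they generate local random variables $Z_A$, $Z_B$ (with values in arbitrary measurable spaces) and exchange messages $M_1,\dots,M_r$ from countable alphabets over an error-free channel, Alice speaking in odd and Bob in even stages. - *Source model $P_{X,Y}$ on $\mathcal X\times\mathcal Y$:* $(X_i,Y_i)_{i\le n}$ are i.i.d. with law $P_{X,Y}$; Alice has $X^n$ and Bob has $Y^n$ from the beginning; $(A^k,B^k)$, $(X^n,Y^n)$, $Z_A$, $Z_B$ are mutually independent. Alice's messages are functions of $(A^k,X^n,Z_A)$ and the earlier messages, Bob's of $(B^k,Y^n,Z_B)$ and the earlier messages.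 - *Channel model $P_{Y|X}$:* $(A^k,B^k)$, $Z_A$, $Z_B$ are mutually independent, and Alice makes $n$ transmissions over the discrete memoryless channel $P_{Y|X}$, interspersed arbitrarily with the discussion stages. The input $X_i$ is a function of $A^k$, $Z_A$, the earlier inputs and the earlier messages; given $X_i$ and everything that happened before, Bob receives $Y_i\sim P_{Y|X}(\cdot|X_i)$. Every message is a function of everything available to its sender at that time. At the end Alice and Bob produce estimates $\hat F^k$, $\hat G^k$ as functions of $(A^k,X^n,Z_A,M^r)$ and $(B^k,Y^n,Z_B,M^r)$. A number $R>0$ is *achievable* if for every $\epsilon>0$ and all sufficiently large $n$ there are $k$ and an acceptable $(n,k)$-protocol with $k/n>R-\epsilon$, $$\Pr[\hat F^k\ne F^k]<\epsilon,\qquad \Pr[\hat G^k\neq G^k]<\epsilon,$$ $$I(A^k;Z_B,Y^n,M^r\mid B^k,G^k)<\epsilon,\qquad I(B^k;Z_A,X^n,M^r\mid A^k,F^k)<\epsilon .$$ The $1$-out-of-$m$ sample-wise oblivious transfer capacity $C_{OT,m}$ (for the uniform source distribution) is the supremum of the achievable rates, and $0$ if there are none. **Theorem.** For source-model correlated randomness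 with any law $P_{X,Y}$ on $\mathcal X\times\mathcal Y$, $$C_{OT,m}\le\min\Bigl(I(X;Y),\ \frac{H(X|Y)}{m-1}\Bigr).$$ For channel-model correlated randomness with any channel $P_{Y|X}$ from $\mathcal X$ to $\mathcal Y$, $$C_{OT,m}\le\max_{P_X}\min\Bigl(I(X;Y),\ \frac{H(X|Y)}{m-1}\Bigr),$$ where the maximum, which is attained, is over all distributions $P_X$ on $\mathcal X$ and $(X,Y)$ has law $P_X(x)P_{Y|X}(y|x)$. -/

import Mathlib

open MeasureTheory ProbabilityTheory

namespace SFC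

noncomputable section

/-! ### Information measures (all in bits) -/

/-- Marginal probability `P_X(x)` of a joint distribution on finite alphabets. -/
def margX {𝒳 𝒴 : Type*} [Fintype 𝒴] (P : PMF (𝒳 × 𝒴)) (x : 𝒳) : ℝ :=
  ∑ y, (P (x, y)).toReal

/-- Marginal probability `P_Y(y)` of a joint distribution on finite alphabets. -/
def margY {𝒳 𝒴 : Type*} [Fintype 𝒳] (P : PMF (𝒳 × 𝒴)) (y : 𝒴) : ℝ :=
  ∑ x, (P (x, y)).toReal

/-- Mutual information `I(X;Y)` of `(X,Y) ∼ P`. Terms with `P(x,y) = 0` vanish. -/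
def mutualInfo {𝒳 𝒴 : Type*} [Fintype 𝒳] [Fintype 𝒴] (P : PMF (𝒳 × 𝒴)) : ℝ :=
  ∑ x, ∑ y, (P (x, y)).toReal *
    Real.logb 2 ((P (x, y)).toReal / (margX P x * margY P y))

/-- Conditional entropy `H(X|Y)` of `(X,Y) ∼ P`. Terms with `P(x,y) = 0` vanish. -/
def condEntropy {𝒳 𝒴 : Type*} [Fintype 𝒳] [Fintype 𝒴] (P : PMF (𝒳 × 𝒴)) : ℝ :=
  -∑ x, ∑ y, (P (x, y)).toReal * Real.logb 2 ((P (x, y)).toReal / margY P y)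

/-- Conditional mutual information `I(U;V|C)` of random variables on `(Ω, μ)`, where `C` takes
finitely many values: the average over `c` of the Kullback-Leibler divergence between the
conditional joint law of `(U,V)` given `C = c` and the product of the conditional marginals. -/
def condMutualInfo {Ω α β γ : Type*} [MeasurableSpace Ω] [MeasurableSpace α] [MeasurableSpace β]
    [Fintype γ] (μ : Measure Ω) (U : Ω → α) (V : Ω → β) (C : Ω → γ) : ENNReal :=
  (∑ c, μ (C ⁻¹' {c}) *
    InformationTheory.klDiv ((μ[|C ⁻¹' {c}]).map fun ω => (U ω, V ω))
      (((μ[|C ⁻¹' {c}]).map U).prod ((μ[|C ⁻¹' {c}]).map V))) / ENNReal.ofReal (Real.log 2)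

/-! ### Protocols -/

/-- The random variables occurring in a run of a two-party protocol with `k` source samples, `n`
samples of correlated randomness and `r` discussion stages. The local randomness takes values in
arbitrary measurable spaces; messages come from a countable alphabet, coded by natural numbers.
Message `M j` with `j : Fin r` is that of stage `j + 1`. -/
structure Run (𝒜 ℬ 𝒳 𝒴 ℛf ℛg : Type*) [MeasurableSpace 𝒜] [MeasurableSpace ℬ]
    [MeasurableSpace 𝒳] [MeasurableSpace 𝒴] [MeasurableSpace ℛf] [MeasurableSpace ℛg]
    (n k : ℕ) where
  /-- the underlying probability space -/
  Ω : Type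
  [measurableSpaceΩ : MeasurableSpace Ω]
  μ : Measure Ω
  [isProbabilityMeasure : IsProbabilityMeasure μ]
  /-- value space of Alice's local randomness -/
  𝒵A : Type
  [measurableSpaceA : MeasurableSpace 𝒵A]
  /-- value space of Bob's local randomness -/
  𝒵B : Type
  [measurableSpaceB : MeasurableSpace 𝒵B]
  A : Ω → Fin k → 𝒜
  B : Ω → Fin k → ℬ
  X : Ω → Fin n → 𝒳
  Y : Ω → Fin n → 𝒴
  ZA : Ω → 𝒵A
  ZB : Ω → 𝒵B
  /-- number of discussion stages -/
  r : ℕ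
  M : Ω → Fin r → ℕ
  /-- Alice's estimate of her function samples -/
  Fhat : Ω → Fin k → ℛf
  /-- Bob's estimate of his function samples -/
  Ghat : Ω → Fin k → ℛg
  measurable_A : Measurable A
  measurable_B : Measurable B
  measurable_X : Measurable X
  measurable_Y : Measurable Y
  measurable_ZA : Measurable ZA
  measurable_ZB : Measurable ZB
  measurable_M : Measurable M
  measurable_Fhat : Measurable Fhat
  measurable_Ghat : Measurable Ghat

attribute [instance] Run.measurableSpaceΩ Run.isProbabilityMeasure Run.measurableSpaceA
  Run.measurableSpaceB

/-- `V` is a (measurable) function of `U`. -/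
def IsFunctionOf {Ω α β : Type*} [MeasurableSpace α] [MeasurableSpace β]
    (V : Ω → β) (U : Ω → α) : Prop :=
  ∃ φ : α → β, Measurable φ ∧ ∀ ω, V ω = φ (U ω)

section

variable {𝒜 ℬ 𝒳 𝒴 ℛf ℛg : Type*} [MeasurableSpace 𝒜] [MeasurableSpace ℬ]
  [MeasurableSpace 𝒳] [MeasurableSpace 𝒴] [MeasurableSpace ℛf] [MeasurableSpace ℛg] {n k : ℕ}

/-- The messages `M_j`, `j < t` (0-indexed), i.e. those of the first `t` stages. -/
def Run.msgBefore (E : Run 𝒜 ℬ 𝒳 𝒴 ℛf ℛg n k) (t : ℕ) (ω : E.Ω) :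
    {j : Fin E.r // (j : ℕ) < t} → ℕ :=
  fun j => E.M ω j

/-- The final estimates are functions of everything available to the respective party. -/
def Run.OutputsAcceptable (E : Run 𝒜 ℬ 𝒳 𝒴 ℛf ℛg n k) : Prop :=
  IsFunctionOf E.Fhat (fun ω => (E.A ω, E.X ω, E.ZA ω, E.M ω)) ∧
  IsFunctionOf E.Ghat (fun ω => (E.B ω, E.Y ω, E.ZB ω, E.M ω))

/-- Acceptable protocol for source-model correlated randomness `P = P_{X,Y}` and joint source
distribution `Q` of `(A^k, B^k)`. -/
structure Run.IsSourceModel (E : Run 𝒜 ℬ 𝒳 𝒴 ℛf ℛg n k)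
    (Q : Measure ((Fin k → 𝒜) × (Fin k → ℬ))) (P : PMF (𝒳 × 𝒴)) : Prop where
  /-- `(A^k, B^k) ∼ Q`, the pairs `(X_i, Y_i)` are i.i.d. `∼ P`, and `(A^k, B^k)`, `(X^n, Y^n)`,
  `Z_A`, `Z_B` are mutually independent. -/
  law : E.μ.map (fun ω => ((E.A ω, E.B ω), (fun i => (E.X ω i, E.Y ω i)), E.ZA ω, E.ZB ω)) =
    Q.prod ((Measure.pi fun _ : Fin n => P.toMeasure).prod
      ((E.μ.map E.ZA).prod (E.μ.map E.ZB)))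
  /-- Alice speaks in stages `1, 3, 5, …`. -/
  alice_msg : ∀ j : Fin E.r, Even (j : ℕ) →
    IsFunctionOf (fun ω => E.M ω j) (fun ω => (E.A ω, E.X ω, E.ZA ω, E.msgBefore j ω))
  /-- Bob speaks in stages `2, 4, 6, …`. -/
  bob_msg : ∀ j : Fin E.r, Odd (j : ℕ) →
    IsFunctionOf (fun ω => E.M ω j) (fun ω => (E.B ω, E.Y ω, E.ZB ω, E.msgBefore j ω))
  outputs : E.OutputsAcceptable

/-- Acceptable protocol for channel-model correlated randomness `W = P_{Y|X}` and joint source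
distribution `Q`, in which the `i`-th transmission takes place after exactly the first `τ i`
discussion stages. -/
structure Run.IsChannelModelWith (E : Run 𝒜 ℬ 𝒳 𝒴 ℛf ℛg n k)
    (Q : Measure ((Fin k → 𝒜) × (Fin k → ℬ))) (W : 𝒳 → PMF 𝒴) (τ : Fin n → ℕ) : Prop where
  monotone_schedule : Monotone τ
  schedule_le : ∀ i, τ i ≤ E.r
  /-- `(A^k, B^k) ∼ Q`, and `(A^k, B^k)`, `Z_A`, `Z_B` are mutually independent. -/
  law : E.μ.map (fun ω => ((E.A ω, E.B ω), E.ZA ω, E.ZB ω)) =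
    Q.prod ((E.μ.map E.ZA).prod (E.μ.map E.ZB))
  /-- Each channel input is a function of everything available to Alice at that time. -/
  input : ∀ i : Fin n,
    IsFunctionOf (fun ω => E.X ω i)
      (fun ω => (E.A ω, (fun l : {l : Fin n // l < i} => E.X ω l), E.ZA ω,
        E.msgBefore (τ i) ω))
  /-- Memoryless channel: given the current input `X_i` and everything that happened before the
  `i`-th transmission, the output `Y_i` has distribution `W(·|X_i)`. -/
  channel : ∀ (i : Fin n) (x : 𝒳) (y : 𝒴)
    (S : Set ((Fin k → 𝒜) × (Fin k → ℬ) × E.𝒵A × E.𝒵B × ({l : Fin n // l < i} → 𝒳) ×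
      ({l : Fin n // l < i} → 𝒴) × ({j : Fin E.r // (j : ℕ) < τ i} → ℕ))), MeasurableSet S →
    E.μ {ω | (E.A ω, E.B ω, E.ZA ω, E.ZB ω, (fun l : {l : Fin n // l < i} => E.X ω l),
        (fun l : {l : Fin n // l < i} => E.Y ω l), E.msgBefore (τ i) ω) ∈ S ∧
        E.X ω i = x ∧ E.Y ω i = y} =
      E.μ {ω | (E.A ω, E.B ω, E.ZA ω, E.ZB ω, (fun l : {l : Fin n // l < i} => E.X ω l),
        (fun l : {l : Fin n // l < i} => E.Y ω l), E.msgBefore (τ i) ω) ∈ S ∧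
        E.X ω i = x} * W x y
  /-- Alice speaks in stages `1, 3, 5, …`, knowing the inputs sent so far. -/
  alice_msg : ∀ j : Fin E.r, Even (j : ℕ) →
    IsFunctionOf (fun ω => E.M ω j)
      (fun ω => (E.A ω, (fun l : {l : Fin n // τ l ≤ j} => E.X ω l), E.ZA ω, E.msgBefore j ω))
  /-- Bob speaks in stages `2, 4, 6, …`, knowing the outputs received so far. -/
  bob_msg : ∀ j : Fin E.r, Odd (j : ℕ) →
    IsFunctionOf (fun ω => E.M ω j)
      (fun ω => (E.B ω, (fun l : {l : Fin n // τ l ≤ j} => E.Y ω l), E.ZB ω, E.msgBefore j ω))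
  outputs : E.OutputsAcceptable

/-- Acceptable protocol for channel-model correlated randomness: the transmissions may be
interspersed arbitrarily with the discussion stages. -/
def Run.IsChannelModel (E : Run 𝒜 ℬ 𝒳 𝒴 ℛf ℛg n k)
    (Q : Measure ((Fin k → 𝒜) × (Fin k → ℬ))) (W : 𝒳 → PMF 𝒴) : Prop :=
  ∃ τ : Fin n → ℕ, E.IsChannelModelWith Q W τ

/-- The function samples `F^k` that Alice wishes to compute. -/
def Run.F (E : Run 𝒜 ℬ 𝒳 𝒴 ℛf ℛg n k) (f : 𝒜 → ℬ → ℛf) (ω : E.Ω) : Fin k → ℛf :=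
  fun i => f (E.A ω i) (E.B ω i)

/-- The function samples `G^k` that Bob wishes to compute. -/
def Run.G (E : Run 𝒜 ℬ 𝒳 𝒴 ℛf ℛg n k) (g : 𝒜 → ℬ → ℛg) (ω : E.Ω) : Fin k → ℛg :=
  fun i => g (E.A ω i) (E.B ω i)

/-- Correctness and privacy up to `ε`. -/
structure Run.IsSecure [Fintype 𝒜] [Fintype ℬ] [Fintype ℛf] [Fintype ℛg]
    (E : Run 𝒜 ℬ 𝒳 𝒴 ℛf ℛg n k) (f : 𝒜 → ℬ → ℛf) (g : 𝒜 → ℬ → ℛg) (ε : ℝ) : Prop where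
  correct_F : E.μ {ω | E.Fhat ω ≠ E.F f ω} < ENNReal.ofReal ε
  correct_G : E.μ {ω | E.Ghat ω ≠ E.G g ω} < ENNReal.ofReal ε
  /-- `I(A^k ; Z_B, Y^n, M^r | B^k, G^k) < ε` -/
  alice_private : condMutualInfo E.μ E.A (fun ω => (E.ZB ω, E.Y ω, E.M ω))
    (fun ω => (E.B ω, E.G g ω)) < ENNReal.ofReal ε
  /-- `I(B^k ; Z_A, X^n, M^r | A^k, F^k) < ε` -/
  bob_private : condMutualInfo E.μ E.B (fun ω => (E.ZA ω, E.X ω, E.M ω))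
    (fun ω => (E.A ω, E.F f ω)) < ENNReal.ofReal ε

end

/-! ### Achievable rates and capacity -/

/-- `R > 0` is an achievable rate, for source distributions `Q k` of `(A^k, B^k)`, functions `f`,
`g`, and the class `acc` of acceptable protocols determined by the correlated randomness. -/
def IsAchievableRate {𝒜 ℬ 𝒳 𝒴 ℛf ℛg : Type*} [MeasurableSpace 𝒜] [MeasurableSpace ℬ]
    [MeasurableSpace 𝒳] [MeasurableSpace 𝒴] [MeasurableSpace ℛf] [MeasurableSpace ℛg]
    [Fintype 𝒜] [Fintype ℬ] [Fintype ℛf] [Fintype ℛg]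
    (f : 𝒜 → ℬ → ℛf) (g : 𝒜 → ℬ → ℛg)
    (acc : ∀ n k : ℕ, Run 𝒜 ℬ 𝒳 𝒴 ℛf ℛg n k → Prop) (R : ℝ) : Prop :=
  0 < R ∧ ∀ ε : ℝ, 0 < ε → ∃ N : ℕ, ∀ n : ℕ, N ≤ n →
    ∃ (k : ℕ) (E : Run 𝒜 ℬ 𝒳 𝒴 ℛf ℛg n k),
      acc n k E ∧ R - ε < (k : ℝ) / (n : ℝ) ∧ E.IsSecure f g ε

/-- Capacity with source-model correlated randomness: the supremum in `[0, ∞]` of the achievable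
rates (which is `0` if there are none). -/
def sourceCapacity {𝒜 ℬ 𝒳 𝒴 ℛf ℛg : Type*} [MeasurableSpace 𝒜] [MeasurableSpace ℬ]
    [MeasurableSpace 𝒳] [MeasurableSpace 𝒴] [MeasurableSpace ℛf] [MeasurableSpace ℛg]
    [Fintype 𝒜] [Fintype ℬ] [Fintype ℛf] [Fintype ℛg]
    (Q : ∀ k : ℕ, Measure ((Fin k → 𝒜) × (Fin k → ℬ)))
    (f : 𝒜 → ℬ → ℛf) (g : 𝒜 → ℬ → ℛg) (P : PMF (𝒳 × 𝒴)) : ENNReal :=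
  ⨆ (R : ℝ) (_ : IsAchievableRate f g
    (fun n k (E : Run 𝒜 ℬ 𝒳 𝒴 ℛf ℛg n k) => E.IsSourceModel (Q k) P) R), ENNReal.ofReal R

/-- Capacity with channel-model correlated randomness: the supremum in `[0, ∞]` of the achievable
rates (which is `0` if there are none). -/
def channelCapacity {𝒜 ℬ 𝒳 𝒴 ℛf ℛg : Type*} [MeasurableSpace 𝒜] [MeasurableSpace ℬ]
    [MeasurableSpace 𝒳] [MeasurableSpace 𝒴] [MeasurableSpace ℛf] [MeasurableSpace ℛg]
    [Fintype 𝒜] [Fintype ℬ] [Fintype ℛf] [Fintype ℛg]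
    (Q : ∀ k : ℕ, Measure ((Fin k → 𝒜) × (Fin k → ℬ)))
    (f : 𝒜 → ℬ → ℛf) (g : 𝒜 → ℬ → ℛg) (W : 𝒳 → PMF 𝒴) : ENNReal :=
  ⨆ (R : ℝ) (_ : IsAchievableRate f g
    (fun n k (E : Run 𝒜 ℬ 𝒳 𝒴 ℛf ℛg n k) => E.IsChannelModel (Q k) W) R), ENNReal.ofReal R

/-! ### Sample-wise oblivious transfer -/

/-- Alice's function in oblivious transfer: the constant `0`. -/
def otF (m : ℕ) : (Fin m → Bool) → Fin m → Fin 1 := fun _ _ => 0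

/-- Bob's function in oblivious transfer: `g((a_1, …, a_m), b) = a_b`. -/
def otG (m : ℕ) : (Fin m → Bool) → Fin m → Bool := fun a b => a b

/-- The uniform source distribution: `(A^k, B^k)` is uniform on `({0,1}^m)^k × {1,…,m}^k`. -/
def uniformSource (m k : ℕ) : Measure ((Fin k → Fin m → Bool) × (Fin k → Fin m)) :=
  uniformOn Set.univ

/-- `C_{OT,m}` for the uniform source distribution and source-model randomness `P_{X,Y} = P`. -/
def otSourceCapacity {𝒳 𝒴 : Type*} [MeasurableSpace 𝒳] [MeasurableSpace 𝒴]
    (m : ℕ) (P : PMF (𝒳 × 𝒴)) : ENNReal :=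
  sourceCapacity (uniformSource m) (otF m) (otG m) P

/-- `C_{OT,m}` for the uniform source distribution and channel-model randomness `P_{Y|X} = W`. -/
def otChannelCapacity {𝒳 𝒴 : Type*} [MeasurableSpace 𝒳] [MeasurableSpace 𝒴]
    (m : ℕ) (W : 𝒳 → PMF 𝒴) : ENNReal :=
  channelCapacity (uniformSource m) (otF m) (otG m) W

/-- `min(I(X;Y), H(X|Y)/(m-1))` for `(X,Y) ∼ P`. -/
def otBound {𝒳 𝒴 : Type*} [Fintype 𝒳] [Fintype 𝒴] (m : ℕ) (P : PMF (𝒳 × 𝒴)) : ℝ :=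
  min (mutualInfo P) (condEntropy P / ((m : ℝ) - 1))

/-- The joint distribution `P_X(x) P_{Y|X}(y|x)`. -/
def jointDist {𝒳 𝒴 : Type*} (PX : PMF 𝒳) (W : 𝒳 → PMF 𝒴) : PMF (𝒳 × 𝒴) :=
  PX.bind fun x => (W x).map fun y => (x, y)

end

end SFC

/-! Two entropy inequalities, valid up to an error of order √ε·k + 1, give the two terms of the
minimum. Let A_{B+j} be the string of k bits obtained by shifting each of Bob's choices cyclically
by j, so that G = A_B.

Alice's privacy leaves the (m-1)k unselected bits of A almost uniform given (Y, M, B, G). Bob's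
privacy makes B almost uniform given (A, X, M). Hence, for N = M or N = (X, M), the entropy
H(A_{B+j} | B, N) is close to the average over fixed choices b of H(A_b | N), which does not depend
on j (`abs_condEnt_sub_average_le`, `sum_condEnt_selectBits`): given (B, N), all m strings are about
equally uncertain.

First term (`rate_le_shared_info`). A_{B+1} has almost k bits of entropy given (B, M), so G has as
well; but G is almost known once Bob's estimate is given too. Thus I(A, X; B, Y, Ghat | M) is at
least about k. Conversely, the joint law is a product of the correlation w(x, y), a factor of Alice
and a factor of Bob, each depending on the transcript. For such a law this information is at most
the expectation of log(w / (s t)), for any weights s(x), t(y) under which the protocol has total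
mass at most one (`condEnt_sub_condEnt_le`). The marginals give n I(X;Y) in the source model; s = 1
and the product of the output marginals give the sum of I(X_i;Y_i) in the channel model.

Second term (`rate_le_condEnt`). By the factorization, Ghat is independent of A given (B, X, M), so
(B, X, M) almost determines G. By Bob's privacy (X, M) then almost determines A_b on average over b,
hence A. The (m-1)k bits of A unknown to Bob must therefore be covered by H(X|Y).

Subadditivity and concavity in the input law reduce both bounds to single letters, and ε tends to 0.
Entropies are in nats and are taken of unnormalized vectors, so that conditional entropies are plain
sums without division by probabilities. -/

namespace SFC

open Real Finset

set_option linter.unusedSectionVars false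
set_option linter.unusedVariables false

/-! ### Entropy of finite nonnegative vectors (in nats, homogeneous of degree one) -/

/-- The entropy `∑ q(a) log (t / q(a))`, `t = ∑ q(a)`, of an unnormalized finite distribution. -/
noncomputable def ent {α : Type*} [Fintype α] (q : α → ℝ) : ℝ :=
  ∑ a, negMulLog (q a) - negMulLog (∑ a, q a)

/-- This is log x ≤ x - 1 at x = q / p, the pointwise form of nonnegativity of relative entropy.
Because `log 0 = 0`, absolute continuity has to be assumed in `h`. -/
lemma sub_le_mul_log_sub_log {p q : ℝ} (hp : 0 ≤ p) (hq : 0 ≤ q) (h : q = 0 → p = 0) :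
    p - q ≤ p * (log p - log q) := by
  rcases hp.eq_or_lt with rfl | hp
  · simpa using hq
  have hq' : 0 < q := lt_of_le_of_ne hq fun h0 => hp.ne' (h h0.symm)
  have := log_le_sub_one_of_pos (div_pos hq' hp)
  rw [log_div hq'.ne' hp.ne'] at this
  have h2 := mul_le_mul_of_nonneg_left this hp.le
  have h3 : p * (q / p - 1) = q - p := by field_simp
  linarith

/-- The same tangent inequality at √(q / p). It bounds relative entropy below by a squared Hellinger
distance, as needed for a Pinsker estimate. -/
lemma two_mul_sub_le_mul_log_sub_log {p q : ℝ} (hp : 0 ≤ p) (hq : 0 ≤ q) (h : q = 0 → p = 0) :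
    2 * p - 2 * (√p * √q) ≤ p * (log p - log q) := by
  rcases hp.eq_or_lt with rfl | hp
  · simp
  have hq' : 0 < q := lt_of_le_of_ne hq fun h0 => hp.ne' (h h0.symm)
  have := log_le_sub_one_of_pos (div_pos (sqrt_pos.2 hq') (sqrt_pos.2 hp))
  rw [log_div (sqrt_pos.2 hq').ne' (sqrt_pos.2 hp).ne', log_sqrt hq, log_sqrt hp.le] at this
  have h2 := mul_le_mul_of_nonneg_left this hp.le
  have h3 : p * (√q / √p - 1) = √p * √q - p := by
    have : 0 < √p := sqrt_pos.2 hp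
    have h4 : p * (√q / √p) = √p * √q := by
      nth_rewrite 1 [← mul_self_sqrt hp.le]
      field_simp
    rw [mul_sub, h4, mul_one]
  linarith

section Finite

variable {α β : Type*} [Fintype α] [Fintype β]

lemma ent_eq_sum (q : α → ℝ) : ent q = ∑ a, q a * (log (∑ a, q a) - log (q a)) := by
  simp only [ent, negMulLog, mul_sub, sum_sub_distrib, ← sum_mul]
  simp only [neg_mul, sum_neg_distrib]
  ring

lemma ent_nonneg {q : α → ℝ} (hq : ∀ a, 0 ≤ q a) : 0 ≤ ent q := by
  rw [ent_eq_sum]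
  refine sum_nonneg fun a _ => ?_
  rcases (hq a).eq_or_lt with h | h
  · simp [← h]
  · exact mul_nonneg h.le (sub_nonneg.2 (log_le_log h
      (single_le_sum (fun i _ => hq i) (mem_univ a))))

@[simp] lemma ent_zero : ent (fun _ : α => (0 : ℝ)) = 0 := by simp [ent]

lemma ent_smul (c : ℝ) (q : α → ℝ) : ent (fun a => c * q a) = c * ent q := by
  simp only [ent, ← mul_sum, negMulLog_mul, sum_add_distrib, ← sum_mul]
  ring

lemma ent_comp_equiv (e : β ≃ α) (q : α → ℝ) : ent (fun b => q (e b)) = ent q := by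
  simp only [ent, e.sum_comp (fun a => negMulLog (q a)), e.sum_comp q]

lemma ent_eq_zero_of_forall_ne {q : α → ℝ} (a₀ : α) (h : ∀ a, a ≠ a₀ → q a = 0) : ent q = 0 := by
  have h1 : ∑ a, q a = q a₀ := Fintype.sum_eq_single a₀ h
  have h2 : ∑ a, negMulLog (q a) = negMulLog (q a₀) :=
    Fintype.sum_eq_single a₀ fun a ha => by simp [h a ha]
  simp [ent, h1, h2]

lemma ent_prod (q : α × β → ℝ) :
    ent q = ent (fun a => ∑ b, q (a, b)) + ∑ a, ent (fun b => q (a, b)) := by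
  simp only [ent, Fintype.sum_prod_type, sum_sub_distrib]
  ring

/-- The deficit from maximal entropy is the relative entropy to the flat vector of the same mass;
both `ent_le` and `sum_abs_sub_le` start from this form. -/
lemma sum_mul_log_card_sub_ent (q : α → ℝ) :
    (∑ a, q a) * log (Fintype.card α) - ent q =
      ∑ a, q a * (log (q a) - log ((∑ a, q a) / Fintype.card α)) := by
  rcases isEmpty_or_nonempty α with h | h
  · simp [ent]
  rcases eq_or_ne (∑ a, q a) 0 with h0 | h0
  · simp [ent_eq_sum, h0]
  have hn : (Fintype.card α : ℝ) ≠ 0 := by simp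
  rw [ent_eq_sum, log_div h0 hn, sum_mul, ← sum_sub_distrib]
  exact sum_congr rfl fun a _ => by ring

lemma ent_le {q : α → ℝ} (hq : ∀ a, 0 ≤ q a) :
    ent q ≤ (∑ a, q a) * log (Fintype.card α) := by
  rcases isEmpty_or_nonempty α with h | h
  · simp [ent]
  have hn : (Fintype.card α : ℝ) ≠ 0 := by simp
  have h0 : 0 ≤ ∑ a, q a := sum_nonneg fun a _ => hq a
  have : ∑ a, (q a - (∑ a, q a) / Fintype.card α) ≤
      ∑ a, q a * (log (q a) - log ((∑ a, q a) / Fintype.card α)) :=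
    sum_le_sum fun a _ => sub_le_mul_log_sub_log (hq a) (by positivity) fun h => by
      rw [div_eq_zero_iff, or_iff_left hn, Fintype.sum_eq_zero_iff_of_nonneg hq] at h
      exact congrFun h a
  rw [← sum_mul_log_card_sub_ent] at this
  simp only [sum_sub_distrib, sum_const, card_univ, nsmul_eq_mul, mul_div_cancel₀ _ hn] at this
  linarith

/-- Concavity together with homogeneity of degree one amounts to superadditivity, so mixtures need
no weights. -/
lemma ent_add_ent_le {q q' : α → ℝ} (hq : ∀ a, 0 ≤ q a) (hq' : ∀ a, 0 ≤ q' a) :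
    ent q + ent q' ≤ ent (fun a => q a + q' a) := by
  rw [ent_eq_sum, ent_eq_sum, ent_eq_sum, sum_add_distrib]
  set t := ∑ a, q a
  set t' := ∑ a, q' a
  have ht : ∀ a, q a ≤ t := fun a => single_le_sum (fun i _ => hq i) (mem_univ a)
  have ht' : ∀ a, q' a ≤ t' := fun a => single_le_sum (fun i _ => hq' i) (mem_univ a)
  rw [← sum_add_distrib]
  refine sum_le_sum fun a _ => ?_
  -- Compares `x` with the share of `x + y` proportional to the total mass `z` of its vector. The
  -- left-hand sides for the two vectors cancel in `k3`.
  have key : ∀ x y z w : ℝ, 0 ≤ x → x ≤ z → 0 ≤ y → y ≤ w →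
      x - z * (x + y) / (z + w) ≤ x * (log x - log z - log (x + y) + log (z + w)) := by
    intro x y z w hx hxz hy hyw
    rcases hx.eq_or_lt with rfl | hx
    · have := hy.trans hyw
      have : 0 ≤ z * (0 + y) / (z + w) := by positivity
      simpa using this
    have hz : 0 < z := hx.trans_le hxz
    have h1 : 0 < x + y := by positivity
    have h2 : 0 < z + w := by linarith
    have := sub_le_mul_log_sub_log (p := x) (q := z * (x + y) / (z + w)) hx.le (by positivity)
      (fun h => absurd h (by positivity))
    rw [log_div (by positivity) h2.ne', log_mul hz.ne' h1.ne'] at this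
    linarith
  have k1 := key _ _ _ _ (hq a) (ht a) (hq' a) (ht' a)
  have k2 := key _ _ _ _ (hq' a) (ht' a) (hq a) (ht a)
  rw [add_comm (q' a), add_comm t'] at k2
  have k3 : q a - t * (q a + q' a) / (t + t') + (q' a - t' * (q a + q' a) / (t + t')) = 0 := by
    rcases eq_or_ne (t + t') 0 with h | h
    · have := hq a; have := hq' a; have := ht a; have := ht' a
      have : q a = 0 := by linarith
      have : q' a = 0 := by linarith
      simp [*]
    · field_simp; ring
  linarith

lemma ent_mono {q q' : α → ℝ} (hq : ∀ a, 0 ≤ q a) (h : ∀ a, q a ≤ q' a) : ent q ≤ ent q' := by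
  have h1 := ent_add_ent_le hq (q' := fun a => q' a - q a) fun a => sub_nonneg.2 (h a)
  have h2 := ent_nonneg (q := fun a => q' a - q a) fun a => sub_nonneg.2 (h a)
  simp only [add_sub_cancel] at h1
  have h3 : ent (fun a => q' a) = ent q' := rfl
  linarith

lemma sum_ent_le {ι : Type*} (s : Finset ι) {q : ι → α → ℝ} (hq : ∀ i a, 0 ≤ q i a) :
    ∑ i ∈ s, ent (q i) ≤ ent (fun a => ∑ i ∈ s, q i a) := by
  classical
  induction s using Finset.induction_on with
  | empty => simp
  | insert i s hi ih =>
    simp only [sum_insert hi]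
    exact (add_le_add le_rfl ih).trans
      (ent_add_ent_le (hq i) fun a => sum_nonneg fun j _ => hq j a)

/-- Labelling the mass by its summand can only raise the entropy, and the label is worth at most log
2 per unit of mass. -/
lemma ent_add_le {q q' : α → ℝ} (hq : ∀ a, 0 ≤ q a) (hq' : ∀ a, 0 ≤ q' a) :
    ent (fun a => q a + q' a) ≤ ent q + ent q' + (∑ a, q a + ∑ a, q' a) * log 2 := by
  simp only [ent_eq_sum, sum_add_distrib]
  set t := ∑ a, q a with htd
  set t' := ∑ a, q' a with htd'
  have ht : 0 ≤ t := sum_nonneg fun a _ => hq a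
  have ht' : 0 ≤ t' := sum_nonneg fun a _ => hq' a
  have key : ∀ x y z : ℝ, 0 ≤ x → 0 ≤ y → x * (z - log (x + y)) ≤ x * (z - log x) := by
    intro x y z hx hy
    rcases hx.eq_or_lt with rfl | hx
    · simp
    · exact mul_le_mul_of_nonneg_left
        (sub_le_sub_left (log_le_log hx (le_add_of_nonneg_right hy)) z) hx.le
  have h1 : ∑ a, (q a + q' a) * (log (t + t') - log (q a + q' a)) ≤
      ∑ a, q a * (log (t + t') - log (q a)) + ∑ a, q' a * (log (t + t') - log (q' a)) := by
    refine (sum_le_sum fun a _ => ?_).trans_eq sum_add_distrib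
    rw [add_mul]
    have k1 := key (q a) (q' a) (log (t + t')) (hq a) (hq' a)
    have k2 := key (q' a) (q a) (log (t + t')) (hq' a) (hq a)
    rw [add_comm (q' a)] at k2
    exact add_le_add k1 k2
  -- Relative entropy of the two masses to the even split: binary entropy is at most log 2.
  have key2 : ∀ x y : ℝ, 0 ≤ x → 0 ≤ y → x - (x + y) / 2 ≤ x * (log x - log (x + y) + log 2) := by
    intro x y hx hy
    rcases hx.eq_or_lt with rfl | hx
    · simp; positivity
    have := sub_le_mul_log_sub_log (p := x) (q := (x + y) / 2) hx.le (by positivity)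
      (fun h => absurd h (by positivity))
    rw [log_div (by positivity) two_ne_zero] at this
    linarith
  have k1 := key2 t t' ht ht'
  have k2 := key2 t' t ht' ht
  rw [add_comm t' t] at k2
  simp only [mul_sub, sum_sub_distrib, ← sum_mul, ← htd, ← htd'] at h1 ⊢
  nlinarith

/-- A Pinsker inequality with a free parameter in place of the square root. Being linear in mass and
entropy, it can be summed over the values of a conditioning variable without Jensen; the choice of
`s` is postponed. -/
lemma sum_abs_sub_le {q : α → ℝ} (hq : ∀ a, 0 ≤ q a) {s : ℝ} (hs : 0 < s) :
    ∑ a, |q a - (∑ a, q a) / Fintype.card α| ≤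
      ((∑ a, q a) * log (Fintype.card α) - ent q) / (2 * s) + 2 * s * ∑ a, q a := by
  rcases isEmpty_or_nonempty α with h | h
  · simp [ent]
  have hn : (Fintype.card α : ℝ) ≠ 0 := by simp
  rw [sum_mul_log_card_sub_ent]
  set t := ∑ a, q a with ht
  have ht0 : 0 ≤ t := sum_nonneg fun a _ => hq a
  set u := t / Fintype.card α with hu
  have hu0 : 0 ≤ u := by positivity
  have hsum : ∑ _a : α, u = t := by
    simp only [sum_const, card_univ, nsmul_eq_mul, hu, mul_div_cancel₀ _ hn]
  have key : ∀ a, |q a - u| ≤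
      (q a * (log (q a) - log u) - q a + u) / (2 * s) + s * (q a + u) := by
    intro a
    have h0 : u = 0 → q a = 0 := fun h => by
      rw [hu, div_eq_zero_iff, or_iff_left hn, ht, Fintype.sum_eq_zero_iff_of_nonneg hq] at h
      exact congrFun h a
    have h1 := two_mul_sub_le_mul_log_sub_log (hq a) hu0 h0
    have e1 := sq_sqrt (hq a)
    have e2 := sq_sqrt hu0
    set x := √(q a)
    set y := √u
    have hxy : 0 ≤ x + y := add_nonneg (sqrt_nonneg _) (sqrt_nonneg _)
    have h2 : |q a - u| = |x - y| * (x + y) := by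
      rw [← e1, ← e2, sq_sub_sq, abs_mul, abs_of_nonneg hxy, mul_comm]
    have h3 : (x - y) ^ 2 ≤ q a * (log (q a) - log u) - q a + u := by nlinarith
    have h4 : (x + y) ^ 2 ≤ 2 * (q a + u) := by nlinarith [sq_nonneg (x - y)]
    -- AM-GM with weight `s` separates the Hellinger part, controlled by relative entropy, from the
    -- mass part.
    have h5 : |x - y| * (x + y) ≤ (x - y) ^ 2 / (2 * s) + s * ((x + y) ^ 2 / 2) := by
      rw [← sq_abs (x - y), ← sub_nonneg]
      have : |x - y| ^ 2 / (2 * s) + s * ((x + y) ^ 2 / 2) - |x - y| * (x + y) =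
        (|x - y| - s * (x + y)) ^ 2 / (2 * s) := by field_simp; ring
      rw [this]; positivity
    rw [h2]
    refine h5.trans (add_le_add ?_ ?_)
    · gcongr
    · gcongr; linarith
  refine (sum_le_sum fun a _ => key a).trans (le_of_eq ?_)
  rw [sum_add_distrib, ← sum_div, ← mul_sum, sum_add_distrib, sum_add_distrib, sum_sub_distrib,
    hsum, ← ht]
  ring

end Finite

/-! ### Conditional entropy given a countably valued random variable -/

/-- Conditional entropy `H(U|V)` in nats; `U` takes finitely and `V` countably many values. -/
noncomputable def condEnt {Ω α β : Type*} [MeasurableSpace Ω] [Fintype α] (μ : Measure Ω)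
    (U : Ω → α) (V : Ω → β) : ℝ :=
  ∑' v, ent fun u => μ.real {ω | U ω = u ∧ V ω = v}

lemma condEnt_map {Ω D α β : Type*} [MeasurableSpace Ω] [MeasurableSpace D]
    [DiscreteMeasurableSpace D] [Fintype α] (μ : Measure Ω) {T : Ω → D} (hT : Measurable T)
    (U : D → α) (V : D → β) :
    condEnt (μ.map T) U V = condEnt μ (fun ω => U (T ω)) (fun ω => V (T ω)) := by
  unfold condEnt
  congr! 5 with v u
  rw [map_measureReal_apply hT (MeasurableSet.of_discrete)]
  rfl

section Discrete

variable {D α α' β β' γ : Type*} [MeasurableSpace D] [DiscreteMeasurableSpace D]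
  (μ : Measure D) [IsFiniteMeasure μ]

lemma hasSum_measureReal_and (p : D → Prop) [Countable β] (V : D → β) :
    HasSum (fun v => μ.real {ω | p ω ∧ V ω = v}) (μ.real {ω | p ω}) := by
  have h := measure_iUnion (μ := μ) (f := fun v => {ω | p ω ∧ V ω = v})
    (fun v w hvw => Set.disjoint_left.2 fun ω h1 h2 => hvw (h1.2.symm.trans h2.2))
    fun v => MeasurableSet.of_discrete
  have h2 : (⋃ v, {ω | p ω ∧ V ω = v}) = {ω | p ω} := by ext; simp
  rw [h2] at h
  have h3 : ∑' v, μ {ω | p ω ∧ V ω = v} ≠ ⊤ := h ▸ measure_ne_top _ _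
  have := (ENNReal.hasSum_toReal h3)
  rw [← ENNReal.tsum_toReal_eq (fun v => measure_ne_top _ _), ← h] at this
  exact this

lemma sum_measureReal_and [Fintype β] (p : D → Prop) (V : D → β) :
    ∑ v, μ.real {ω | p ω ∧ V ω = v} = μ.real {ω | p ω} :=
  (hasSum_fintype _).unique (hasSum_measureReal_and μ p V)

lemma sum_measureReal_and_left [Fintype α] (p : D → Prop) (U : D → α) :
    ∑ u, μ.real {ω | U ω = u ∧ p ω} = μ.real {ω | p ω} := by
  simp_rw [and_comm (b := p _)]
  exact sum_measureReal_and μ p U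

variable [Fintype α] [Fintype α'] [Countable β] [Countable β']

lemma ent_measureReal_le (U : D → α) (p : D → Prop) :
    ent (fun u => μ.real {ω | U ω = u ∧ p ω}) ≤ μ.real {ω | p ω} * log (Fintype.card α) := by
  rw [← sum_measureReal_and_left μ p U]
  exact ent_le fun u => measureReal_nonneg

lemma hasSum_measureReal_eq (V : D → β) :
    HasSum (fun v => μ.real {ω | V ω = v}) (μ.real Set.univ) := by
  simpa using hasSum_measureReal_and μ (fun _ => True) V

lemma summable_ent (U : D → α) (V : D → β) :
    Summable fun v => ent fun u => μ.real {ω | U ω = u ∧ V ω = v} :=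
  Summable.of_nonneg_of_le (fun v => ent_nonneg fun u => measureReal_nonneg)
    (fun v => ent_measureReal_le μ U _)
    ((hasSum_measureReal_eq μ V).summable.mul_right (log (Fintype.card α)))

lemma condEnt_nonneg (U : D → α) (V : D → β) : 0 ≤ condEnt μ U V :=
  tsum_nonneg fun v => ent_nonneg fun u => measureReal_nonneg

lemma condEnt_le (U : D → α) (V : D → β) :
    condEnt μ U V ≤ μ.real Set.univ * log (Fintype.card α) := by
  rw [← ((hasSum_measureReal_eq μ V).mul_right (log (Fintype.card α))).tsum_eq]
  exact (summable_ent μ U V).tsum_le_tsum (fun v => ent_measureReal_le μ U _)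
    ((hasSum_measureReal_eq μ V).summable.mul_right _)

/-- Conditioning on less increases entropy. -/
lemma condEnt_mono_right (U : D → α) {V : D → β} {V' : D → β'} (f : β → β')
    (h : ∀ ω, V' ω = f (V ω)) : condEnt μ U V ≤ condEnt μ U V' := by
  -- Grouping the values of `V` by the fibres of `f` reduces the claim to superadditivity and
  -- monotonicity of `ent` on each fibre.
  have h1 := (summable_ent μ U V).hasSum.tsum_fiberwise f
  unfold condEnt
  rw [← h1.tsum_eq]
  refine h1.summable.tsum_le_tsum (fun w => ?_) (summable_ent μ U V')
  refine Real.tsum_le_of_sum_le (fun v => ent_nonneg fun u => measureReal_nonneg) fun s => ?_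
  refine (sum_ent_le s fun v u => measureReal_nonneg).trans
    (ent_mono (fun u => sum_nonneg fun v _ => measureReal_nonneg) fun u => ?_)
  have h2 : Set.PairwiseDisjoint (s : Set (f ⁻¹' {w})) fun v => {ω | U ω = u ∧ V ω = v} :=
    fun v _ v' _ hvv' => Set.disjoint_left.2 fun ω h1 h2 =>
      hvv' (Subtype.ext (h1.2.symm.trans h2.2))
  rw [← measureReal_biUnion_finset h2 fun _ _ => MeasurableSet.of_discrete]
  refine measureReal_mono ?_
  intro ω hω
  simp only [Set.mem_iUnion, Set.mem_ofPred_eq, exists_prop] at hω ⊢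
  obtain ⟨v, _, h3, h4⟩ := hω
  exact ⟨h3, by rw [h, h4]; exact v.2⟩

lemma condEnt_congr_right (U : D → α) {V : D → β} {V' : D → β'} (f : β → β') (g : β' → β)
    (h : ∀ ω, V' ω = f (V ω)) (h' : ∀ ω, V ω = g (V' ω)) : condEnt μ U V = condEnt μ U V' :=
  le_antisymm (condEnt_mono_right μ U f h) (condEnt_mono_right μ U g h')

/-- Summing out the finite component leaves one term for each value of `V`, ready for termwise
comparison with entropies given `V` alone. -/
lemma hasSum_condEnt_prod [Fintype γ] (U : D → α) (W : D → γ) (V : D → β) :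
    HasSum (fun v => ∑ w, ent fun u => μ.real {ω | U ω = u ∧ (W ω, V ω) = (w, v)})
      (condEnt μ U (fun ω => (W ω, V ω))) := by
  have hs := summable_ent μ U (fun ω => (W ω, V ω))
  have h1 : condEnt μ U (fun ω => (W ω, V ω)) =
      ∑' v, ∑ w, ent fun u => μ.real {ω | U ω = u ∧ (W ω, V ω) = (w, v)} := by
    rw [condEnt, hs.tsum_prod, tsum_fintype, Summable.tsum_finsetSum]
    exact fun u _ => hs.prod_factor u
  rw [h1]
  exact (summable_sum fun u _ => hs.prod_factor u).hasSum

/-- Chain rule. -/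
lemma condEnt_pair (U : D → α) (U' : D → α') (V : D → β) :
    condEnt μ (fun ω => (U ω, U' ω)) V = condEnt μ U V + condEnt μ U' (fun ω => (U ω, V ω)) := by
  rw [← (hasSum_condEnt_prod μ U' U V).tsum_eq, condEnt, condEnt,
    ← (summable_ent μ U V).tsum_add (hasSum_condEnt_prod μ U' U V).summable]
  congr 1 with v
  rw [ent_prod]
  congr 1
  · congr 1 with u
    rw [← sum_measureReal_and μ (fun ω => U ω = u ∧ V ω = v) U']
    refine sum_congr rfl fun u' _ => congrArg _ (Set.ext fun ω => ?_)
    simp only [Prod.mk.injEq, Set.mem_ofPred_eq]; tauto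
  · refine sum_congr rfl fun u _ => congrArg _ (funext fun u' => congrArg _ (Set.ext fun ω => ?_))
    simp only [Prod.mk.injEq, Set.mem_ofPred_eq]; tauto

lemma condEnt_eq_zero {U : D → α} {V : D → β} (f : β → α) (h : ∀ ω, U ω = f (V ω)) :
    condEnt μ U V = 0 := by
  unfold condEnt
  rw [← tsum_zero]
  congr 1 with v
  refine ent_eq_zero_of_forall_ne (f v) fun u hu => ?_
  have : {ω | U ω = u ∧ V ω = v} = ∅ := by
    ext ω; simp only [Set.mem_ofPred_eq, Set.mem_empty_iff_false, iff_false, not_and]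
    rintro h1 rfl; exact hu (h1.symm.trans (h ω))
  simp [this]

lemma condEnt_swap (U : D → α) (U' : D → α') (V : D → β) :
    condEnt μ (fun ω => (U ω, U' ω)) V = condEnt μ (fun ω => (U' ω, U ω)) V := by
  unfold condEnt
  congr 1 with v
  rw [← ent_comp_equiv (Equiv.prodComm α α')]
  congr! 4 with u ω
  simp [Prod.ext_iff, and_comm]

lemma condEnt_le_pair (U : D → α) (U' : D → α') (V : D → β) :
    condEnt μ U V ≤ condEnt μ (fun ω => (U ω, U' ω)) V := by
  rw [condEnt_pair]
  exact le_add_of_nonneg_right (condEnt_nonneg μ _ _)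

/-- A function of `(U, V)` together with `U` has the entropy of `U` given `V`. -/
lemma condEnt_eq_add {U : D → α} {U' : D → α'} {V : D → β} (φ : α → β → α')
    (h : ∀ ω, U' ω = φ (U ω) (V ω)) :
    condEnt μ U V = condEnt μ U' V + condEnt μ U (fun ω => (U' ω, V ω)) := by
  rw [← condEnt_pair, condEnt_swap, condEnt_pair,
    condEnt_eq_zero μ (U := U') (fun uv : α × β => φ uv.1 uv.2) h, add_zero]

lemma condEnt_comp_le {U : D → α} {U' : D → α'} {V : D → β} (φ : α → β → α')
    (h : ∀ ω, U' ω = φ (U ω) (V ω)) : condEnt μ U' V ≤ condEnt μ U V := by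
  rw [condEnt_eq_add μ φ h]
  exact le_add_of_nonneg_right (condEnt_nonneg μ _ _)

/-- Data processing for conditional mutual information. -/
lemma condEnt_sub_comp_le {U : D → α} {U' : D → α'} {V : D → β} {W : D → β'} (φ : α → β → α')
    (h : ∀ ω, U' ω = φ (U ω) (V ω)) :
    condEnt μ U' V - condEnt μ U' (fun ω => (V ω, W ω)) ≤
      condEnt μ U V - condEnt μ U (fun ω => (V ω, W ω)) := by
  rw [condEnt_eq_add μ φ h, condEnt_eq_add μ (V := fun ω => (V ω, W ω))
    (fun u vw => φ u vw.1) h]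
  have := condEnt_mono_right μ U (V := fun ω => (U' ω, V ω, W ω)) (V' := fun ω => (U' ω, V ω))
    (fun x => (x.1, x.2.1)) (fun _ => rfl)
  linarith

lemma condEnt_pair_le_add (U : D → α) (U' : D → α') (V : D → β) :
    condEnt μ (fun ω => (U ω, U' ω)) V ≤ condEnt μ U V + condEnt μ U' V := by
  rw [condEnt_pair]
  gcongr
  exact condEnt_mono_right μ U' Prod.snd fun _ => rfl

/-- Subadditivity of entropy. -/
lemma condEnt_pi_le (V : D → β) : ∀ {n : ℕ} (U : Fin n → D → α),
    condEnt μ (fun ω i => U i ω) V ≤ ∑ i, condEnt μ (U i) V := by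
  intro n
  induction n with
  | zero =>
    intro U
    rw [condEnt_eq_zero μ (U := fun ω (i : Fin 0) => U i ω) (fun _ i => i.elim0)
      (fun ω => Subsingleton.elim _ _)]
    simp
  | succ n ih =>
    intro U
    rw [Fin.sum_univ_succ]
    calc condEnt μ (fun ω i => U i ω) V
        ≤ condEnt μ (fun ω => (U 0 ω, fun i : Fin n => U i.succ ω)) V :=
          condEnt_comp_le μ (fun x _ => Fin.cons x.1 x.2) fun ω => by
            funext i; refine Fin.cases ?_ (fun j => ?_) i <;> rfl
      _ ≤ _ := condEnt_pair_le_add μ _ _ _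
      _ ≤ _ := by gcongr; exact ih _

/-- Conditionally independent side information does not decrease entropy. -/
lemma condEnt_le_of_factor [Fintype γ] {U : D → α} {V : D → β} {W : D → γ} (f : α → β → ℝ)
    (g : γ → β → ℝ) (h : ∀ u v w, μ.real {ω | U ω = u ∧ V ω = v ∧ W ω = w} = f u v * g w v) :
    condEnt μ U V ≤ condEnt μ U (fun ω => (W ω, V ω)) := by
  rw [← (hasSum_condEnt_prod μ U W V).tsum_eq, condEnt]
  refine le_of_eq (tsum_congr fun v => ?_)
  have h2 : ∀ u, μ.real {ω | U ω = u ∧ V ω = v} = (∑ w, g w v) * f u v := fun u => by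
    rw [← sum_measureReal_and μ (fun ω => U ω = u ∧ V ω = v) W, sum_mul]
    refine sum_congr rfl fun w _ => ?_
    rw [mul_comm, ← h]; simp only [and_assoc]
  have h3 : ∀ w u, μ.real {ω | U ω = u ∧ (W ω, V ω) = (w, v)} = g w v * f u v := fun w u => by
    rw [mul_comm, ← h]; simp only [Prod.mk.injEq, and_comm]
  simp only [h2, h3, ent_smul]
  rw [sum_mul]

end Discrete

/-! ### Continuity of conditional entropy -/

/-- Split `q` into `min q q'`, dominated by `q'`, and an excess whose entropy is at most its mass
times `log (card α)`. The split itself costs log 2 per unit of mass. -/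
lemma ent_le_add_dist {α : Type*} [Fintype α] {q q' : α → ℝ} (hq : ∀ a, 0 ≤ q a)
    (hq' : ∀ a, 0 ≤ q' a) :
    ent q ≤ ent q' + (∑ a, |q a - q' a|) * log (Fintype.card α) + (∑ a, q a) * log 2 := by
  have hν : ∀ a, 0 ≤ min (q a) (q' a) := fun a => le_min (hq a) (hq' a)
  have hρ : ∀ a, 0 ≤ q a - min (q a) (q' a) := fun a => sub_nonneg.2 (min_le_left _ _)
  have h1 := ent_add_le hν hρ
  have h2 := ent_mono hν fun a => min_le_right (q a) (q' a)
  have h3 := ent_le hρ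
  have h4 : ∑ a, (q a - min (q a) (q' a)) ≤ ∑ a, |q a - q' a| := sum_le_sum fun a _ => by
    rcases le_total (q a) (q' a) with h | h
    · simp [h]
    · simp [h, le_abs_self]
  have h5 : 0 ≤ log (Fintype.card α) := log_natCast_nonneg _
  have h6 := mul_le_mul_of_nonneg_right h4 h5
  simp only [add_sub_cancel, ← sum_add_distrib] at h1
  have h7 : ent (fun a => q a) = ent q := rfl
  linarith

section Discrete

variable {D α β γ ν : Type*} [MeasurableSpace D] [DiscreteMeasurableSpace D]
  (μ : Measure D) [IsFiniteMeasure μ] [Fintype α] [Fintype β] [Fintype γ] [Countable ν]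

/-- Fano's inequality. -/
lemma condEnt_le_of_estimate (U : D → α) (V : D → ν) (f : ν → α) :
    condEnt μ U V ≤ μ.real {ω | U ω ≠ f (V ω)} * log (Fintype.card α) +
      μ.real Set.univ * log 2 := by
  classical
  have h1 := ((hasSum_measureReal_and μ (fun ω => U ω ≠ f (V ω)) V).mul_right
    (log (Fintype.card α))).add ((hasSum_measureReal_eq μ V).mul_right (log 2))
  refine hasSum_le (fun v => ?_) (summable_ent μ U V).hasSum h1
  -- The comparison vector keeps only the mass at the estimate: its entropy is zero and its distance
  -- is the mass of the error event.
  have h2 := ent_le_add_dist (q := fun u => μ.real {ω | U ω = u ∧ V ω = v})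
    (q' := fun u => if u = f v then μ.real {ω | U ω = u ∧ V ω = v} else 0)
    (fun u => measureReal_nonneg) (fun u => by split_ifs <;> simp)
  rw [ent_eq_zero_of_forall_ne (f v) (fun u hu => if_neg hu), zero_add,
    sum_measureReal_and_left μ (fun ω => V ω = v) U] at h2
  refine h2.trans_eq ?_
  congr 2
  symm
  rw [← sum_measureReal_and_left μ (fun ω => U ω ≠ f (V ω) ∧ V ω = v) U]
  refine sum_congr rfl fun u _ => ?_
  split_ifs with hu
  · rw [sub_self, abs_zero]
    convert measureReal_empty
    ext ω
    simp only [Set.mem_ofPred_eq, Set.mem_empty_iff_false, iff_false]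
    rintro ⟨rfl, h, rfl⟩; exact h hu
  · rw [sub_zero, abs_of_nonneg measureReal_nonneg]
    congr 1; ext ω
    simp only [Set.mem_ofPred_eq]
    constructor
    · rintro ⟨rfl, _, rfl⟩; exact ⟨rfl, rfl⟩
    · rintro ⟨rfl, rfl⟩; exact ⟨rfl, hu, rfl⟩

lemma sum_measureReal_and_eq (p : D → Prop) (A : D → α) (φ : α → γ) (c : γ) [DecidableEq γ] :
    μ.real {ω | φ (A ω) = c ∧ p ω} = ∑ a, if φ a = c then μ.real {ω | A ω = a ∧ p ω} else 0 := by
  rw [← sum_measureReal_and_left μ (fun ω => φ (A ω) = c ∧ p ω) A]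
  refine sum_congr rfl fun a _ => ?_
  split_ifs with h
  · congr 1; ext ω; simp only [Set.mem_ofPred_eq]
    constructor
    · rintro ⟨rfl, _, h⟩; exact ⟨rfl, h⟩
    · rintro ⟨rfl, h'⟩; exact ⟨rfl, h, h'⟩
  · convert measureReal_empty
    ext ω
    simp only [Set.mem_ofPred_eq, Set.mem_empty_iff_false, iff_false]
    rintro ⟨rfl, h', _⟩; exact h h'

lemma sum_abs_sum_ite_le (φ : α → γ) (f g : α → ℝ) [DecidableEq γ] :
    ∑ c, |(∑ a, if φ a = c then f a else 0) - ∑ a, if φ a = c then g a else 0| ≤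
      ∑ a, |f a - g a| := by
  calc _ ≤ ∑ c, ∑ a, if φ a = c then |f a - g a| else 0 := by
        refine sum_le_sum fun c _ => ?_
        rw [← sum_sub_distrib]
        refine (abs_sum_le_sum_abs _ _).trans (le_of_eq (sum_congr rfl fun a _ => ?_))
        split_ifs <;> simp
    _ = _ := by rw [sum_comm]; simp

/-- If `B` is almost uniform and independent of `(A, N)`, then the entropy of `φ_B(A)` given
`(B, N)` is close to the average over `b` of the entropy of `φ_b(A)` given `N`. -/
lemma abs_condEnt_sub_average_le (A : D → α) (B : D → β) (N : D → ν) (φ : β → α → γ) {s : ℝ}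
    (hs : 0 < s) :
    |condEnt μ (fun ω => φ (B ω) (A ω)) (fun ω => (B ω, N ω)) -
      (Fintype.card β : ℝ)⁻¹ * ∑ b, condEnt μ (fun ω => φ b (A ω)) N| ≤
      ((μ.real Set.univ * log (Fintype.card β) - condEnt μ B (fun ω => (A ω, N ω))) / (2 * s) +
        2 * s * μ.real Set.univ) * log (Fintype.card γ) + μ.real Set.univ * log 2 := by
  classical
  -- The empty sample space is set aside so that `β` is nonempty and its cardinality can be
  -- inverted.
  rcases isEmpty_or_nonempty D with hD | ⟨⟨ω₀⟩⟩
  · have : μ = 0 := Measure.eq_zero_of_isEmpty μ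
    subst this
    simp [condEnt]
  have : Nonempty β := ⟨B ω₀⟩
  have hβ : (Fintype.card β : ℝ) ≠ 0 := by simp
  set q : ν → β → γ → ℝ := fun n b c =>
    μ.real {ω | φ (B ω) (A ω) = c ∧ (B ω, N ω) = (b, n)} with hq
  -- The ideal joint masses, in which `B` is uniform and independent of `(A, N)`.
  set q' : ν → β → γ → ℝ := fun n b c =>
    (Fintype.card β : ℝ)⁻¹ * μ.real {ω | φ b (A ω) = c ∧ N ω = n} with hq'
  set d : ν → β → α → ℝ := fun n b a => |μ.real {ω | B ω = b ∧ (A ω, N ω) = (a, n)} -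
    μ.real {ω | A ω = a ∧ N ω = n} / Fintype.card β| with hd
  have hq0 : ∀ n b c, 0 ≤ q n b c := fun n b c => measureReal_nonneg
  have hq0' : ∀ n b c, 0 ≤ q' n b c := fun n b c => by positivity
  have hqd : ∀ n b, ∑ c, |q n b c - q' n b c| ≤ ∑ a, d n b a := by
    intro n b
    refine le_trans (le_of_eq ?_) (sum_abs_sum_ite_le (φ b) _ _)
    refine sum_congr rfl fun c _ => ?_
    have e1 : q n b c = ∑ a, if φ b a = c then μ.real {ω | B ω = b ∧ (A ω, N ω) = (a, n)}
        else 0 := by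
      have : q n b c = μ.real {ω | φ b (A ω) = c ∧ (B ω = b ∧ N ω = n)} := by
        simp only [hq]
        congr 1; ext ω; simp only [Set.mem_ofPred_eq, Prod.mk.injEq]
        constructor
        · rintro ⟨h, rfl, h'⟩; exact ⟨h, rfl, h'⟩
        · rintro ⟨h, rfl, h'⟩; exact ⟨h, rfl, h'⟩
      rw [this, sum_measureReal_and_eq]
      refine sum_congr rfl fun a _ => ?_
      congr 2; ext ω; simp only [Set.mem_ofPred_eq, Prod.mk.injEq]; tauto
    have e2 : q' n b c = ∑ a, if φ b a = c then μ.real {ω | A ω = a ∧ N ω = n} /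
        Fintype.card β else 0 := by
      simp only [hq']
      rw [sum_measureReal_and_eq, mul_sum]
      refine sum_congr rfl fun a _ => ?_
      split_ifs
      · rw [div_eq_inv_mul]
      · simp
    rw [e1, e2]
  have hdsum : ∀ n, ∑ b, ∑ a, d n b a ≤
      (μ.real {ω | N ω = n} * log (Fintype.card β) -
        ∑ a, ent fun b => μ.real {ω | B ω = b ∧ (A ω, N ω) = (a, n)}) / (2 * s) +
        2 * s * μ.real {ω | N ω = n} := by
    intro n
    rw [sum_comm]
    have h1 : ∀ a, ∑ b, μ.real {ω | B ω = b ∧ (A ω, N ω) = (a, n)} =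
        μ.real {ω | A ω = a ∧ N ω = n} := fun a => by
      rw [sum_measureReal_and_left]; simp only [Prod.mk.injEq]
    have h2 : ∑ a, μ.real {ω | A ω = a ∧ N ω = n} = μ.real {ω | N ω = n} :=
      sum_measureReal_and_left μ _ A
    refine (sum_le_sum fun a _ => ?_).trans_eq
      (b := ∑ a, ((μ.real {ω | A ω = a ∧ N ω = n} * log (Fintype.card β) -
        ent fun b => μ.real {ω | B ω = b ∧ (A ω, N ω) = (a, n)}) / (2 * s) +
        2 * s * μ.real {ω | A ω = a ∧ N ω = n})) ?_
    · have := sum_abs_sub_le (q := fun b => μ.real {ω | B ω = b ∧ (A ω, N ω) = (a, n)})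
        (fun b => measureReal_nonneg) hs
      rw [h1] at this
      exact this
    · rw [sum_add_distrib, ← sum_div, sum_sub_distrib, ← sum_mul, ← mul_sum, h2]
  have hsumq : ∀ n, ∑ b, ∑ c, q n b c = μ.real {ω | N ω = n} := fun n => by
    rw [← sum_measureReal_and_left μ (fun ω => N ω = n) B]
    refine sum_congr rfl fun b _ => ?_
    simp only [hq]
    rw [sum_measureReal_and_left]; simp only [Prod.mk.injEq]
  have hsumq' : ∀ n, ∑ b, ∑ c, q' n b c = μ.real {ω | N ω = n} := fun n => by
    simp only [hq', ← mul_sum]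
    have : ∀ b, ∑ c, μ.real {ω | φ b (A ω) = c ∧ N ω = n} = μ.real {ω | N ω = n} :=
      fun b => sum_measureReal_and_left μ _ _
    simp only [this, sum_const, card_univ, nsmul_eq_mul, inv_mul_cancel_left₀ hβ]
  have H1 : HasSum (fun n => ∑ b, ent (q n b)) (condEnt μ (fun ω => φ (B ω) (A ω))
      (fun ω => (B ω, N ω))) := hasSum_condEnt_prod μ _ B N
  have H2 : HasSum (fun n => ∑ b, ent (q' n b)) ((Fintype.card β : ℝ)⁻¹ *
      ∑ b, condEnt μ (fun ω => φ b (A ω)) N) := by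
    simp only [hq', ent_smul, ← mul_sum]
    exact (hasSum_sum fun b _ => (summable_ent μ (fun ω => φ b (A ω)) N).hasSum).mul_left _
  have H3 := ((((hasSum_measureReal_eq μ N).mul_right (log (Fintype.card β))).sub
    (hasSum_condEnt_prod μ B A N)).div_const (2 * s)).add
    ((hasSum_measureReal_eq μ N).mul_left (2 * s))
  have H4 := (H3.mul_right (log (Fintype.card γ))).add
    ((hasSum_measureReal_eq μ N).mul_right (log 2))
  have hlog : 0 ≤ log (Fintype.card γ) := log_natCast_nonneg _
  -- The actual and ideal families have the same mass for each `n`, so one estimate serves both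
  -- directions of the absolute value.
  have key : ∀ q₁ q₂ : ν → β → γ → ℝ, (∀ n b c, 0 ≤ q₁ n b c) → (∀ n b c, 0 ≤ q₂ n b c) →
      (∀ n b, ∑ c, |q₁ n b c - q₂ n b c| ≤ ∑ a, d n b a) →
      (∀ n, ∑ b, ∑ c, q₁ n b c = μ.real {ω | N ω = n}) → ∀ n, ∑ b, ent (q₁ n b) ≤
      ∑ b, ent (q₂ n b) + (((μ.real {ω | N ω = n} * log (Fintype.card β) -
        ∑ a, ent fun b => μ.real {ω | B ω = b ∧ (A ω, N ω) = (a, n)}) / (2 * s) +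
        2 * s * μ.real {ω | N ω = n}) * log (Fintype.card γ) +
        μ.real {ω | N ω = n} * log 2) := by
    intro q₁ q₂ h1 h2 h3 h4 n
    have h5 := sum_le_sum fun b (_ : b ∈ univ) => ent_le_add_dist (h1 n b) (h2 n b)
    rw [sum_add_distrib, sum_add_distrib, ← sum_mul, ← sum_mul, h4] at h5
    have h6 := mul_le_mul_of_nonneg_right
      ((sum_le_sum fun b (_ : b ∈ univ) => h3 n b).trans (hdsum n)) hlog
    linarith
  rw [abs_sub_le_iff]
  constructor
  · rw [sub_le_iff_le_add']
    exact hasSum_le (key q q' hq0 hq0' hqd hsumq) H1 (H2.add H4)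
  · rw [sub_le_iff_le_add']
    refine hasSum_le (key q' q hq0' hq0 (fun n b => ?_) hsumq') H2 (H1.add H4)
    simp only [abs_sub_comm (q' n b _)]
    exact hqd n b

end Discrete

/-! ### Information created by an interactive protocol -/

lemma log_sum_inequality {α : Type*} [Fintype α] {p a : α → ℝ} (hp : ∀ i, 0 ≤ p i)
    (ha : ∀ i, 0 ≤ a i) (h : ∀ i, a i = 0 → p i = 0) :
    (∑ i, p i) * (log (∑ i, p i) - log (∑ i, a i)) ≤ ∑ i, p i * (log (p i) - log (a i)) := by
  set T := ∑ i, p i with hT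
  set S := ∑ i, a i with hS
  have hT0 : 0 ≤ T := sum_nonneg fun i _ => hp i
  have hS0 : 0 ≤ S := sum_nonneg fun i _ => ha i
  rcases hT0.eq_or_lt with hT1 | hT1
  · have h0 : ∀ i, p i = 0 := by
      have := (Fintype.sum_eq_zero_iff_of_nonneg hp).1 (hT.symm.trans hT1.symm)
      exact congrFun this
    simp [← hT1, h0]
  have hS1 : 0 < S := by
    refine lt_of_le_of_ne hS0 fun h0 => hT1.ne' ?_
    have := (Fintype.sum_eq_zero_iff_of_nonneg ha).1 (hS.symm.trans h0.symm)
    exact sum_eq_zero fun i _ => h i (congrFun this i)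
  have key : ∀ i, p i - a i * (T / S) ≤
      p i * (log (p i) - log (a i)) - p i * (log T - log S) := by
    intro i
    rcases (ha i).eq_or_lt with h0 | h0
    · simp [h i h0.symm, ← h0]
    have := sub_le_mul_log_sub_log (p := p i) (q := a i * (T / S)) (hp i) (by positivity)
      (fun h => absurd h (by positivity))
    rw [log_mul h0.ne' (by positivity), log_div hT1.ne' hS1.ne'] at this
    linarith
  have h2 := sum_le_sum fun i (_ : i ∈ univ) => key i
  rw [sum_sub_distrib, sum_sub_distrib, ← sum_mul, ← sum_mul, ← hT, ← hS,
    mul_div_cancel₀ _ hS1.ne', sub_self] at h2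
  linarith

/-- As p = w α β, the unnormalized mutual information is the expected log(w / (s t)) plus T log T,
minus the relative entropies of the marginals of p to s α and t β. By the log-sum inequality these
are at least T log(T / S) and T log(T / S'), where T, S, S' are the total masses. Then T log(T / (S
S')) ≥ T - S S' turns the error into a difference of masses that can be summed over transcripts. -/
lemma ent_sub_sum_ent_le {υ κ : Type*} [Fintype υ] [Fintype κ] {p w : υ → κ → ℝ} {α s : υ → ℝ}
    {β t : κ → ℝ} (hp : ∀ u v, p u v = w u v * α u * β v) (hw : ∀ u v, 0 ≤ w u v)
    (hα : ∀ u, 0 ≤ α u) (hβ : ∀ v, 0 ≤ β v) (hs : ∀ u, 0 ≤ s u) (ht : ∀ v, 0 ≤ t v)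
    (hst : ∀ u v, p u v ≠ 0 → s u ≠ 0 ∧ t v ≠ 0) :
    ent (fun u => ∑ v, p u v) - ∑ v, ent (fun u => p u v) ≤
      ∑ u, ∑ v, p u v * (log (w u v) - log (s u) - log (t v)) +
        ∑ u, ∑ v, s u * t v * α u * β v - ∑ u, ∑ v, p u v := by
  have hp0 : ∀ u v, 0 ≤ p u v := fun u v => by
    rw [hp]; exact mul_nonneg (mul_nonneg (hw u v) (hα u)) (hβ v)
  set T := ∑ u, ∑ v, p u v with hT
  have hT' : ∑ v, ∑ u, p u v = T := sum_comm
  have hT0 : 0 ≤ T := sum_nonneg fun u _ => sum_nonneg fun v _ => hp0 u v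
  set p₁ : υ → ℝ := fun u => ∑ v, p u v with hp₁
  set p₂ : κ → ℝ := fun v => ∑ u, p u v with hp₂
  have hsα : ∀ u, s u * α u = 0 → p₁ u = 0 := fun u h => sum_eq_zero fun v _ => by
    by_contra hne
    refine (mul_eq_zero.1 h).elim (hst u v hne).1 fun h0 => hne ?_
    rw [hp, h0]; ring
  have htβ : ∀ v, t v * β v = 0 → p₂ v = 0 := fun v h => sum_eq_zero fun u _ => by
    by_contra hne
    refine (mul_eq_zero.1 h).elim (hst u v hne).2 fun h0 => hne ?_
    rw [hp, h0]; ring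
  have l1 := log_sum_inequality (p := p₁) (a := fun u => s u * α u)
    (fun u => sum_nonneg fun v _ => hp0 u v) (fun u => mul_nonneg (hs u) (hα u)) hsα
  have l2 := log_sum_inequality (p := p₂) (a := fun v => t v * β v)
    (fun v => sum_nonneg fun u _ => hp0 u v) (fun v => mul_nonneg (ht v) (hβ v)) htβ
  have e1 : ent p₁ = ∑ u, ∑ v, p u v * (log T - log (p₁ u)) := by
    rw [ent_eq_sum]
    exact sum_congr rfl fun u _ => by rw [← sum_mul]
  have e2 : ∑ v, ent (fun u => p u v) = ∑ u, ∑ v, p u v * (log (p₂ v) - log (p u v)) := by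
    rw [sum_comm]
    exact sum_congr rfl fun v _ => by rw [ent_eq_sum]
  have e3 : ∀ u v, p u v * (log T - log (p₁ u)) - p u v * (log (p₂ v) - log (p u v)) =
      p u v * (log (w u v) - log (s u) - log (t v)) + p u v * log T -
      p u v * (log (p₁ u) - log (s u * α u)) - p u v * (log (p₂ v) - log (t v * β v)) := by
    intro u v
    by_cases h : p u v = 0
    · simp [h]
    obtain ⟨h1, h2⟩ := hst u v h
    have h3 : w u v * α u * β v ≠ 0 := fun h0 => h ((hp u v).trans h0)
    rw [mul_ne_zero_iff, mul_ne_zero_iff] at h3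
    have h4 : log (p u v) = log (w u v) + log (α u) + log (β v) := by
      rw [hp, log_mul (mul_ne_zero h3.1.1 h3.1.2) h3.2, log_mul h3.1.1 h3.1.2]
    rw [h4, log_mul h1 h3.1.2, log_mul h2 h3.2]
    ring
  have e4 : ent p₁ - ∑ v, ent (fun u => p u v) =
      ∑ u, ∑ v, p u v * (log (w u v) - log (s u) - log (t v)) + T * log T -
      ∑ u, p₁ u * (log (p₁ u) - log (s u * α u)) -
      ∑ v, p₂ v * (log (p₂ v) - log (t v * β v)) := by
    have e5 : ∑ v, p₂ v * (log (p₂ v) - log (t v * β v)) =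
        ∑ u, ∑ v, p u v * (log (p₂ v) - log (t v * β v)) := by
      rw [sum_comm]; exact sum_congr rfl fun v _ => by rw [sum_mul]
    have e6 : ∑ u, p₁ u * (log (p₁ u) - log (s u * α u)) =
        ∑ u, ∑ v, p u v * (log (p₁ u) - log (s u * α u)) :=
      sum_congr rfl fun u _ => by rw [sum_mul]
    have e0 : T * log T = ∑ u, ∑ v, p u v * log T := by simp only [← sum_mul]; rfl
    rw [e1, e2, e5, e6, e0]
    simp only [← sum_sub_distrib, ← sum_add_distrib, e3]
  have e7 : ∑ u, ∑ v, s u * t v * α u * β v = (∑ u, s u * α u) * ∑ v, t v * β v := by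
    rw [sum_mul_sum]
    exact sum_congr rfl fun u _ => sum_congr rfl fun v _ => by ring
  have hS0 : 0 ≤ ∑ u, s u * α u := sum_nonneg fun u _ => mul_nonneg (hs u) (hα u)
  have hS0' : 0 ≤ ∑ v, t v * β v := sum_nonneg fun v _ => mul_nonneg (ht v) (hβ v)
  rw [e4, e7]
  set S := ∑ u, s u * α u
  set S' := ∑ v, t v * β v
  have l1' : T * (log T - log S) ≤ ∑ u, p₁ u * (log (p₁ u) - log (s u * α u)) := l1
  have l2' : T * (log T - log S') ≤ ∑ v, p₂ v * (log (p₂ v) - log (t v * β v)) := by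
    rw [← hT']; exact l2
  have hTS : S = 0 → T = 0 := fun h => by
    have := (Fintype.sum_eq_zero_iff_of_nonneg (f := fun u => s u * α u)
      (fun u => mul_nonneg (hs u) (hα u))).1 h
    exact sum_eq_zero fun u _ => hsα u (congrFun this u)
  have hTS' : S' = 0 → T = 0 := fun h => by
    have := (Fintype.sum_eq_zero_iff_of_nonneg (f := fun v => t v * β v)
      (fun v => mul_nonneg (ht v) (hβ v))).1 h
    rw [← hT']
    exact sum_eq_zero fun v _ => htβ v (congrFun this v)
  have l3 : T - S * S' ≤ T * (log T - (log S + log S')) := by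
    by_cases hz : S * S' = 0
    · have : T = 0 := (mul_eq_zero.1 hz).elim hTS hTS'
      simp [this, hz]
    · rw [← log_mul (left_ne_zero_of_mul hz) (right_ne_zero_of_mul hz)]
      exact sub_le_mul_log_sub_log hT0 (mul_nonneg hS0 hS0') fun h => absurd h hz
  linarith

/-- The information that two parties share given the transcript, when the joint law factors, is at
most the divergence of the correlation `w` from a product weight `s ⊗ t` for which the protocol
has total mass at most one. -/
lemma condEnt_sub_condEnt_le {D υ κ ν : Type*} [MeasurableSpace D] [DiscreteMeasurableSpace D]
    (μ : Measure D) [IsProbabilityMeasure μ] [Fintype υ] [Fintype κ] [Countable ν]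
    (U : D → υ) (V : D → κ) (N : D → ν) {w : υ → κ → ℝ} {s : υ → ℝ} {t : κ → ℝ}
    {α : υ → ν → ℝ} {β : κ → ν → ℝ}
    (hp : ∀ u v n, μ.real {ω | U ω = u ∧ V ω = v ∧ N ω = n} = w u v * α u n * β v n)
    (hw : ∀ u v, 0 ≤ w u v) (hα : ∀ u n, 0 ≤ α u n) (hβ : ∀ v n, 0 ≤ β v n)
    (hs : ∀ u, 0 ≤ s u) (ht : ∀ v, 0 ≤ t v)
    (hst : ∀ u v, μ.real {ω | U ω = u ∧ V ω = v} ≠ 0 → s u ≠ 0 ∧ t v ≠ 0)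
    (href : ∀ F : Finset ν, ∑ n ∈ F, ∑ u, ∑ v, s u * t v * α u n * β v n ≤ 1) :
    condEnt μ U N - condEnt μ U (fun ω => (V ω, N ω)) ≤
      ∑ u, ∑ v, μ.real {ω | U ω = u ∧ V ω = v} * (log (w u v) - log (s u) - log (t v)) := by
  have H1 := (summable_ent μ U N).hasSum.sub (hasSum_condEnt_prod μ U V N)
  have H2 : HasSum (fun n => ∑ u, ∑ v, μ.real {ω | U ω = u ∧ V ω = v ∧ N ω = n} *
      (log (w u v) - log (s u) - log (t v)))
      (∑ u, ∑ v, μ.real {ω | U ω = u ∧ V ω = v} * (log (w u v) - log (s u) - log (t v))) := by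
    refine hasSum_sum fun u _ => hasSum_sum fun v _ => HasSum.mul_right _ ?_
    simpa only [and_assoc] using hasSum_measureReal_and μ (fun ω => U ω = u ∧ V ω = v) N
  have H3 := hasSum_measureReal_eq μ N
  rw [probReal_univ] at H3
  -- The transcript masses have sum one and the reference masses at most one; the added constant 1
  -- carries this balance through the partial sums.
  have H4 := Filter.Tendsto.add_const (1 : ℝ) (H2.sub H3)
  rw [sub_add_cancel] at H4
  refine le_of_tendsto_of_tendsto' H1 H4 fun F => ?_
  have hn : ∀ u v n, μ.real {ω | U ω = u ∧ V ω = v} = 0 →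
      μ.real {ω | U ω = u ∧ V ω = v ∧ N ω = n} = 0 := fun u v n h =>
    le_antisymm (h ▸ measureReal_mono fun ω hω => ⟨hω.1, hω.2.1⟩) measureReal_nonneg
  have key : ∀ n, (ent fun u => μ.real {ω | U ω = u ∧ N ω = n}) -
      ∑ v, (ent fun u => μ.real {ω | U ω = u ∧ (V ω, N ω) = (v, n)}) ≤
      ∑ u, ∑ v, μ.real {ω | U ω = u ∧ V ω = v ∧ N ω = n} *
        (log (w u v) - log (s u) - log (t v)) +
        ∑ u, ∑ v, s u * t v * α u n * β v n - μ.real {ω | N ω = n} := by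
    intro n
    have h1 := ent_sub_sum_ent_le (fun u v => hp u v n) hw (fun u => hα u n) (fun v => hβ v n)
      hs ht (fun u v h => hst u v fun h0 => h (hn u v n h0))
    have h2 : ∀ u, ∑ v, μ.real {ω | U ω = u ∧ V ω = v ∧ N ω = n} =
        μ.real {ω | U ω = u ∧ N ω = n} := fun u => by
      rw [← sum_measureReal_and μ _ V]
      refine sum_congr rfl fun v _ => congrArg _ (Set.ext fun ω => ?_)
      simp only [Set.mem_ofPred_eq]; tauto
    simp only [h2] at h1
    rw [sum_measureReal_and_left μ (fun ω => N ω = n) U] at h1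
    simpa only [Prod.mk.injEq] using h1
  have h3 := sum_le_sum fun n (_ : n ∈ F) => key n
  rw [sum_sub_distrib (g := fun n => μ.real {ω | N ω = n}), sum_add_distrib] at h3
  have h4 := href F
  rw [sum_sub_distrib (g := fun n => μ.real {ω | N ω = n})]
  linarith

/-! ### Oblivious transfer over discrete probability spaces -/

/-- A joint mass that does not depend on `u` means that `U` is uniform given `V`, so the deficit to
the flat vector vanishes. -/
lemma condEnt_eq_of_uniform {D α β : Type*} [MeasurableSpace D] [DiscreteMeasurableSpace D]
    (μ : Measure D) [IsFiniteMeasure μ] [Fintype α] [Countable β] {U : D → α} {V : D → β}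
    (κ : β → ℝ) (h : ∀ u v, μ.real {ω | U ω = u ∧ V ω = v} = κ v) :
    condEnt μ U V = μ.real Set.univ * log (Fintype.card α) := by
  rw [← ((hasSum_measureReal_eq μ V).mul_right (log (Fintype.card α))).tsum_eq, condEnt]
  refine tsum_congr fun v => ?_
  rw [← sum_measureReal_and_left μ (fun ω => V ω = v) U, eq_comm, ← sub_eq_zero,
    sum_mul_log_card_sub_ent]
  rcases isEmpty_or_nonempty α with hα | hα
  · simp
  have hc : (Fintype.card α : ℝ) ≠ 0 := by simp
  simp [h, mul_div_cancel_left₀ _ hc]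

section Transfer

variable {D 𝒳 𝒴 ℳ : Type*} [MeasurableSpace D] [DiscreteMeasurableSpace D]
  [Fintype 𝒳] [Fintype 𝒴] [Countable ℳ] {m k : ℕ} [NeZero m]
  (μ : Measure D) [IsProbabilityMeasure μ]
  {A : D → Fin k → Fin m → Bool} {B : D → Fin k → Fin m} {X : D → 𝒳} {Y : D → 𝒴}
  {G : D → Fin k → Bool} {Ghat : D → Fin k → Bool} {M : D → ℳ} {η ε s : ℝ}

lemma log_card_bits (k : ℕ) : log (Fintype.card (Fin k → Bool)) = k * log 2 := by simp

/-- The choice `b`, shifted cyclically by `j`, of one bit out of each of `k` blocks. -/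
def selectBits (j : Fin m) (b : Fin k → Fin m) (a : Fin k → Fin m → Bool) : Fin k → Bool :=
  fun i => a i (b i + j)

/-- The `m` cyclic shifts of a choice read each bit of each block exactly once, so together they
recover `A`; subadditivity does the rest. The choice may depend on the conditioning variable, as it
must for Bob's own choice. -/
lemma condEnt_le_sum_selectBits {ν : Type*} [Countable ν] (V : D → ν) (b : ν → Fin k → Fin m) :
    condEnt μ A V ≤ ∑ j, condEnt μ (fun ω => selectBits j (b (V ω)) (A ω)) V := by
  refine le_trans ?_ (condEnt_pi_le μ V (fun j ω => selectBits j (b (V ω)) (A ω)))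
  exact condEnt_comp_le μ (fun f v i l => f (l - b v i) i) fun ω => by
    funext i l; simp [selectBits]

/-- Shifting by `j` permutes the choices, so an average over all of them cannot distinguish selected
bits from unselected ones. -/
lemma sum_condEnt_selectBits {ν : Type*} [Countable ν] (N : D → ν) (j : Fin m) :
    ∑ b, condEnt μ (fun ω => selectBits j b (A ω)) N =
      ∑ b, condEnt μ (fun ω => selectBits 0 b (A ω)) N := by
  rw [← Equiv.sum_comp (Equiv.addRight (fun _ : Fin k => j))
    (fun b => condEnt μ (fun ω => selectBits 0 b (A ω)) N)]
  refine sum_congr rfl fun b _ => ?_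
  congr 1
  funext ω i
  simp [selectBits]

/-- The reference value is the same for all `j`. Using this for two shifts shows that the selected
string and a shifted one have nearly equal entropy given `(B, N)`; this is the form in which Bob's
privacy enters. -/
lemma abs_condEnt_selectBits_sub_le {ν : Type*} [Countable ν] (N : D → ν)
    (hB : log (Fintype.card (Fin k → Fin m)) - condEnt μ B (fun ω => (A ω, N ω)) ≤ η)
    (hs : 0 < s) (j : Fin m) :
    |condEnt μ (fun ω => selectBits j (B ω) (A ω)) (fun ω => (B ω, N ω)) -
      (Fintype.card (Fin k → Fin m) : ℝ)⁻¹ * ∑ b, condEnt μ (fun ω => selectBits 0 b (A ω)) N| ≤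
      (η / (2 * s) + 2 * s) * (k * log 2) + log 2 := by
  have h := abs_condEnt_sub_average_le μ A B N (selectBits j) hs
  rw [sum_condEnt_selectBits, probReal_univ, one_mul, one_mul, mul_one, log_card_bits] at h
  refine h.trans ?_
  gcongr

/-- Given `B`, the entropy of `A` is that of `m * k` bits; `G` accounts for at most `k` of them, and
Bob's view removes at most `η` more. -/
lemma le_condEnt_of_private
    (hG : ∀ ω, G ω = selectBits 0 (B ω) (A ω))
    (hAB : ∀ a b, μ.real {ω | A ω = a ∧ B ω = b} =
      (Fintype.card (Fin k → Fin m → Bool) : ℝ)⁻¹ * (Fintype.card (Fin k → Fin m) : ℝ)⁻¹)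
    (hη : condEnt μ A (fun ω => (B ω, G ω)) -
      condEnt μ A (fun ω => ((Y ω, M ω), (B ω, G ω))) ≤ η) :
    (m - 1) * (k * log 2) - η ≤ condEnt μ A (fun ω => ((Y ω, M ω), (B ω, G ω))) := by
  have h1 : condEnt μ A B = m * (k * log 2) := by
    rw [condEnt_eq_of_uniform μ (fun _ => _) hAB]
    simp
    ring
  have h2 := condEnt_eq_add μ (U := A) (U' := G) (V := B) (fun a b => selectBits 0 b a) hG
  have h3 := condEnt_le μ G B
  rw [probReal_univ, one_mul, log_card_bits] at h3
  rw [condEnt_congr_right μ A (V := fun ω => (G ω, B ω)) (V' := fun ω => (B ω, G ω))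
    Prod.swap Prod.swap (fun _ => rfl) (fun _ => rfl)] at h2
  linarith

/-- `B` is uniform given `A`, and Alice's view removes at most `η` from its entropy; passing to a
function of `(X, M)` can only raise it again. -/
lemma log_card_sub_condEnt_le
    (hAB : ∀ a b, μ.real {ω | A ω = a ∧ B ω = b} =
      (Fintype.card (Fin k → Fin m → Bool) : ℝ)⁻¹ * (Fintype.card (Fin k → Fin m) : ℝ)⁻¹)
    (hη' : condEnt μ B A - condEnt μ B (fun ω => ((X ω, M ω), A ω)) ≤ η)
    {ν : Type*} [Countable ν] (N : D → ν) (f : 𝒳 × ℳ → ν)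
    (hN : ∀ ω, N ω = f (X ω, M ω)) :
    log (Fintype.card (Fin k → Fin m)) - condEnt μ B (fun ω => (A ω, N ω)) ≤ η := by
  have h1 : condEnt μ B A = log (Fintype.card (Fin k → Fin m)) := by
    rw [condEnt_eq_of_uniform μ (fun _ => (Fintype.card (Fin k → Fin m → Bool) : ℝ)⁻¹ *
      (Fintype.card (Fin k → Fin m) : ℝ)⁻¹) (fun b a => ?_), probReal_univ, one_mul]
    rw [← hAB a b]
    congr 1; ext ω; simp only [Set.mem_ofPred_eq, and_comm]
  have h2 := condEnt_mono_right μ B (V := fun ω => ((X ω, M ω), A ω))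
    (V' := fun ω => (A ω, N ω)) (fun x => (x.2, f x.1)) (fun ω => by rw [hN])
  linarith

lemma condEnt_estimate_le
    (hε : μ.real {ω | Ghat ω ≠ G ω} ≤ ε)
    {ν : Type*} [Countable ν] (V : D → ν) (f : ν → Fin k → Bool)
    (hV : ∀ ω, Ghat ω = f (V ω)) : condEnt μ G V ≤ ε * (k * log 2) + log 2 := by
  have h := condEnt_le_of_estimate μ G V f
  rw [probReal_univ, one_mul, log_card_bits] at h
  refine h.trans ?_
  have : μ.real {ω | G ω ≠ f (V ω)} ≤ ε := by
    simpa only [← hV, ne_comm] using hε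
  gcongr

/-- Lower bound for the information shared by the two parties given the transcript. -/
lemma rate_le_shared_info
    (hG : ∀ ω, G ω = selectBits 0 (B ω) (A ω))
    (hAB : ∀ a b, μ.real {ω | A ω = a ∧ B ω = b} =
      (Fintype.card (Fin k → Fin m → Bool) : ℝ)⁻¹ * (Fintype.card (Fin k → Fin m) : ℝ)⁻¹)
    (hη : condEnt μ A (fun ω => (B ω, G ω)) -
      condEnt μ A (fun ω => ((Y ω, M ω), (B ω, G ω))) ≤ η)
    (hη' : condEnt μ B A - condEnt μ B (fun ω => ((X ω, M ω), A ω)) ≤ η)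
    (hε : μ.real {ω | Ghat ω ≠ G ω} ≤ ε)
    (hs : 0 < s)
    (hm : 2 ≤ m) :
    k * log 2 - η - 2 * ((η / (2 * s) + 2 * s) * (k * log 2) + log 2) -
      (ε * (k * log 2) + log 2) ≤
    condEnt μ (fun ω => (A ω, X ω)) M -
      condEnt μ (fun ω => (A ω, X ω)) (fun ω => ((B ω, Y ω, Ghat ω), M ω)) := by
  have h0 := le_condEnt_of_private μ hG hAB hη
  have h1 := condEnt_le_sum_selectBits μ (A := A) (fun ω => ((Y ω, M ω), (B ω, G ω)))
    (fun v => v.2.1)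
  -- Shift 0 is `G`, which is given, and the shifts other than 0 and 1 carry at most `k` bits each.
  -- What remains of the lower bound `h0` falls on shift 1.
  have h2 : ∑ j, condEnt μ (fun ω => selectBits j (B ω) (A ω))
      (fun ω => ((Y ω, M ω), (B ω, G ω))) ≤
      condEnt μ (fun ω => selectBits 1 (B ω) (A ω)) (fun ω => ((Y ω, M ω), (B ω, G ω))) +
      (m - 2) * (k * log 2) := by
    obtain ⟨m, rfl⟩ := Nat.exists_eq_add_of_le' hm
    rw [Fin.sum_univ_succ, Fin.sum_univ_succ, condEnt_eq_zero μ
      (U := fun ω => selectBits 0 (B ω) (A ω)) (fun v => v.2.2) (fun ω => (hG ω).symm), zero_add]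
    refine add_le_add le_rfl ?_
    have : ∀ j : Fin m, condEnt μ (fun ω => selectBits j.succ.succ (B ω) (A ω))
      (fun ω => ((Y ω, M ω), (B ω, G ω))) ≤ k * log 2 := fun j => by
      refine (condEnt_le μ _ _).trans ?_
      rw [probReal_univ, one_mul, log_card_bits]
    refine (sum_le_sum fun j _ => this j).trans_eq ?_
    simp
  have h3 := condEnt_mono_right μ (fun ω => selectBits 1 (B ω) (A ω))
    (V := fun ω => ((Y ω, M ω), (B ω, G ω))) (V' := fun ω => (B ω, M ω))
    (fun x => (x.2.1, x.1.2)) (fun _ => rfl)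
  have hBM := log_card_sub_condEnt_le μ hAB hη' M Prod.snd (fun _ => rfl)
  -- The uncertainty of shift 1 given `(B, M)` is transferred to shift 0, that is to `G`. Fano in
  -- `h6` removes it once `Ghat` is also given, and data processing in `h7` turns the drop into
  -- information about `(A, X)`.
  have h4 := abs_condEnt_selectBits_sub_le μ M hBM hs 1
  have h5 := abs_condEnt_selectBits_sub_le μ M hBM hs 0
  rw [abs_sub_le_iff] at h4 h5
  have hG' : G = fun ω => selectBits 0 (B ω) (A ω) := funext hG
  rw [← hG'] at h5
  have h6 := condEnt_estimate_le μ hε (fun ω => ((B ω, M ω), (Y ω, Ghat ω)))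
    (fun v => v.2.2) (fun _ => rfl)
  have h7 := condEnt_sub_comp_le μ (U := fun ω => (A ω, X ω)) (U' := G)
    (V := fun ω => (B ω, M ω)) (W := fun ω => (Y ω, Ghat ω))
    (fun ax bm => selectBits 0 bm.1 ax.1) hG
  have h8 := condEnt_mono_right μ (fun ω => (A ω, X ω)) (V := fun ω => (B ω, M ω)) (V' := M)
    Prod.snd (fun _ => rfl)
  have h9 := condEnt_congr_right μ (fun ω => (A ω, X ω))
    (V := fun ω => ((B ω, M ω), (Y ω, Ghat ω))) (V' := fun ω => ((B ω, Y ω, Ghat ω), M ω))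
    (fun v => ((v.1.1, v.2.1, v.2.2), v.1.2)) (fun v => ((v.1.1, v.2), (v.1.2.1, v.1.2.2)))
    (fun _ => rfl) (fun _ => rfl)
  linarith [h4.1, h4.2, h5.1, h5.2]

/-- Lower bound for the uncertainty of Bob about the correlated randomness of Alice. -/
lemma rate_le_condEnt
    (hG : ∀ ω, G ω = selectBits 0 (B ω) (A ω))
    (hAB : ∀ a b, μ.real {ω | A ω = a ∧ B ω = b} =
      (Fintype.card (Fin k → Fin m → Bool) : ℝ)⁻¹ * (Fintype.card (Fin k → Fin m) : ℝ)⁻¹)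
    (hη : condEnt μ A (fun ω => (B ω, G ω)) -
      condEnt μ A (fun ω => ((Y ω, M ω), (B ω, G ω))) ≤ η)
    (hη' : condEnt μ B A - condEnt μ B (fun ω => ((X ω, M ω), A ω)) ≤ η)
    (hε : μ.real {ω | Ghat ω ≠ G ω} ≤ ε)
    (hs : 0 < s)
    {f : (Fin k → Fin m → Bool) → 𝒳 → ℳ → ℝ}
    {g : (Fin k → Fin m) → (Fin k → Bool) → 𝒳 → ℳ → ℝ}
    (hfac : ∀ a x b gh n, μ.real {ω | A ω = a ∧ (B ω, X ω, M ω) = (b, x, n) ∧ Ghat ω = gh} =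
      f a x n * g b gh x n) :
    (m - 1) * (k * log 2) - η ≤ condEnt μ X Y + m * ((ε * (k * log 2) + log 2) +
      ((η / (2 * s) + 2 * s) * (k * log 2) + log 2)) := by
  have h0 := le_condEnt_of_private μ hG hAB hη
  have h1 := condEnt_le_pair μ A X (fun ω => ((Y ω, M ω), (B ω, G ω)))
  rw [condEnt_swap, condEnt_pair] at h1
  have h2 := condEnt_mono_right μ X (V := fun ω => ((Y ω, M ω), (B ω, G ω))) (V' := Y)
    (fun v => v.1.1) (fun _ => rfl)
  have h3 := condEnt_mono_right μ A (V := fun ω => (X ω, ((Y ω, M ω), (B ω, G ω))))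
    (V' := fun ω => (X ω, M ω)) (fun v => (v.1, v.2.1.2)) (fun _ => rfl)
  have hBN := log_card_sub_condEnt_le μ hAB hη' (fun ω => (X ω, M ω)) id (fun _ => rfl)
  have h5 := abs_condEnt_selectBits_sub_le μ (fun ω => (X ω, M ω)) hBN hs 0
  rw [abs_sub_le_iff] at h5
  have hG' : G = fun ω => selectBits 0 (B ω) (A ω) := funext hG
  rw [← hG'] at h5
  have h6 := condEnt_estimate_le μ hε (fun ω => ((B ω, X ω, M ω), Ghat ω))
    (fun v => v.2) (fun _ => rfl)
  have h7 := condEnt_sub_comp_le μ (U := A) (U' := G)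
    (V := fun ω => (B ω, X ω, M ω)) (W := Ghat) (fun a v => selectBits 0 v.1 a) hG
  -- Given `(B, X, M)` the estimate is independent of `A`, so it carries no information about `G`;
  -- hence the Fano bound `h6` holds without `Ghat` in the condition.
  have h8 := condEnt_le_of_factor μ (U := A) (V := fun ω => (B ω, X ω, M ω)) (W := Ghat)
    (fun a v => f a v.2.1 v.2.2) (fun gh v => g v.1 gh v.2.1 v.2.2)
    (fun a v gh => hfac a v.2.1 v.1 gh v.2.2)
  rw [condEnt_congr_right μ A (V := fun ω => (Ghat ω, B ω, X ω, M ω))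
    (V' := fun ω => ((B ω, X ω, M ω), Ghat ω)) Prod.swap Prod.swap
    (fun _ => rfl) (fun _ => rfl)] at h8
  -- For each fixed choice the `m` shifts recover `A`; after averaging over the choices their `m`
  -- contributions coincide.
  have h9 : condEnt μ A (fun ω => (X ω, M ω)) ≤ m * ((Fintype.card (Fin k → Fin m) : ℝ)⁻¹ *
      ∑ b, condEnt μ (fun ω => selectBits 0 b (A ω)) (fun ω => (X ω, M ω))) := by
    have hc : 0 < (Fintype.card (Fin k → Fin m) : ℝ) := Nat.cast_pos.2 Fintype.card_pos
    have e1 : ∀ b : Fin k → Fin m, condEnt μ A (fun ω => (X ω, M ω)) ≤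
        ∑ j, condEnt μ (fun ω => selectBits j b (A ω)) (fun ω => (X ω, M ω)) := fun b =>
      condEnt_le_sum_selectBits μ (A := A) (fun ω => (X ω, M ω)) (fun _ => b)
    have e2 := sum_le_sum fun b (_ : b ∈ univ) => e1 b
    rw [sum_comm] at e2
    simp only [sum_condEnt_selectBits, sum_const, card_univ, nsmul_eq_mul, Fintype.card_fin] at e2
    rw [mul_left_comm, ← div_eq_inv_mul, le_div_iff₀ hc, mul_comm]
    exact e2
  have h10 : (m : ℝ) * ((Fintype.card (Fin k → Fin m) : ℝ)⁻¹ *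
      ∑ b, condEnt μ (fun ω => selectBits 0 b (A ω)) (fun ω => (X ω, M ω))) ≤
      m * ((ε * (k * log 2) + log 2) + ((η / (2 * s) + 2 * s) * (k * log 2) + log 2)) := by
    gcongr
    linarith [h5.1, h5.2]
  linarith

end Transfer

/-! ### Conditional mutual information and conditional entropy -/

section

variable {α β : Type*} [Fintype α] [Countable β] [MeasurableSpace α] [MeasurableSpace β]
  [DiscreteMeasurableSpace α] [DiscreteMeasurableSpace β]

open InformationTheory in
-- Only a lower bound for the divergence is needed. Since `klFun` is nonnegative, its integral
-- dominates the sum over any finite set of atoms, and these sums converge to the left-hand side.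
lemma ent_sub_condEnt_le_klDiv (P : Measure (α × β)) [IsProbabilityMeasure P]
    (h : klDiv P ((P.map Prod.fst).prod (P.map Prod.snd)) ≠ ⊤) :
    ent (fun u => P.real {ω | ω.1 = u}) - condEnt P Prod.fst Prod.snd ≤
      (klDiv P ((P.map Prod.fst).prod (P.map Prod.snd))).toReal := by
  classical
  have : IsProbabilityMeasure (P.map Prod.fst) := Measure.isProbabilityMeasure_map (by fun_prop)
  have : IsProbabilityMeasure (P.map Prod.snd) := Measure.isProbabilityMeasure_map (by fun_prop)
  set Q := (P.map Prod.fst).prod (P.map Prod.snd) with hQ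
  obtain ⟨hac, hint⟩ := klDiv_ne_top_iff.1 h
  rw [toReal_klDiv_eq_integral_klFun hac]
  have hint' : Integrable (fun x => klFun (P.rnDeriv Q x).toReal) Q :=
    (integrable_klFun_rnDeriv_iff hac).2 hint
  set p₁ : α → ℝ := fun u => P.real {ω | ω.1 = u} with hp₁
  set p₂ : β → ℝ := fun v => P.real {ω | ω.2 = v} with hp₂
  set p : β → α → ℝ := fun v u => P.real {ω | ω.1 = u ∧ ω.2 = v} with hp
  have hp1 : ∀ v, ∑ u, p v u = p₂ v := fun v => sum_measureReal_and_left P _ _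
  have hp2 : ∀ u, HasSum (fun v => p v u) (p₁ u) := fun u => hasSum_measureReal_and P _ _
  have hsum1 : ∑ u, p₁ u = 1 := by
    rw [← probReal_univ (μ := P)]
    exact (hasSum_fintype _).unique (hasSum_measureReal_eq P Prod.fst)
  have hpP : ∀ u v, p v u = P.real {(u, v)} := fun u v => by
    simp only [hp]; congr 1; ext ω; simp [Prod.ext_iff]
  have hQpq : ∀ u v, Q.real {(u, v)} = p₁ u * p₂ v := fun u v => by
    rw [hQ, ← Set.singleton_prod_singleton, measureReal_prod_prod,
      map_measureReal_apply (by fun_prop) (MeasurableSet.of_discrete),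
      map_measureReal_apply (by fun_prop) (MeasurableSet.of_discrete)]
    rfl
  have hrn : ∀ e, (P.rnDeriv Q e).toReal * Q.real {e} = P.real {e} := fun e => by
    have h1 := Measure.setLIntegral_rnDeriv hac {e}
    rw [lintegral_singleton] at h1
    rw [Measure.real, Measure.real, ← ENNReal.toReal_mul, h1]
  -- The terms `p₁ u * p₂ v - p v u` come from the correction 1 - r in `klFun` and cancel after
  -- summation over `u`.
  have hterm : ∀ u v, Q.real {(u, v)} • klFun (P.rnDeriv Q (u, v)).toReal =
      p v u * (log (p v u) - log (p₂ v)) - p v u * log (p₁ u) + p₁ u * p₂ v - p v u := by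
    intro u v
    have h1 := hrn (u, v)
    rw [← hpP] at h1
    rw [klFun_apply, smul_eq_mul, ← h1]
    have hq := hQpq u v
    set r := (P.rnDeriv Q (u, v)).toReal
    by_cases hr : r = 0
    · simp [hr, hq]
    by_cases hq0 : Q.real {(u, v)} = 0
    · simp [hq0, ← hq]
    have hq1 := hq0
    rw [hq, ← ne_eq, mul_ne_zero_iff] at hq1
    rw [log_mul hr hq0, hq, log_mul hq1.1 hq1.2]
    ring
  have H1 : HasSum (fun v => -ent (p v) - ∑ u, p v u * log (p₁ u))
      (-condEnt P Prod.fst Prod.snd - ∑ u, p₁ u * log (p₁ u)) :=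
    (summable_ent P Prod.fst Prod.snd).hasSum.neg.sub
      (hasSum_sum fun u _ => (hp2 u).mul_right _)
  have hent : ent p₁ = - ∑ u, p₁ u * log (p₁ u) := by
    rw [ent_eq_sum, hsum1]; simp
  rw [hent, sub_eq_add_neg, add_comm, ← sub_eq_add_neg]
  refine le_of_tendsto' H1 fun F => ?_
  have h2 : ∑ e ∈ univ ×ˢ F, Q.real {e} • klFun (P.rnDeriv Q e).toReal ≤
      ∫ x, klFun (P.rnDeriv Q x).toReal ∂Q := by
    rw [← setIntegral_finset _ hint'.integrableOn]
    exact setIntegral_le_integral hint'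
      (Filter.Eventually.of_forall fun x => klFun_nonneg ENNReal.toReal_nonneg)
  refine le_trans (le_of_eq ?_) h2
  rw [sum_product_right]
  refine sum_congr rfl fun v _ => ?_
  simp only [hterm, sum_sub_distrib, sum_add_distrib, ← sum_mul, hp1, hsum1]
  rw [ent_eq_sum, hp1, ← sum_neg_distrib]
  have : ∀ u, -(p v u * (log (p₂ v) - log (p v u))) = p v u * (log (p v u) - log (p₂ v)) :=
    fun u => by ring
  simp only [this]
  ring

open InformationTheory in
-- `T` serves to discard the local randomness, whose value space is arbitrary, and to keep countably
-- many values; divergence does not increase under such a map. The factor log 2 converts bits to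
-- nats.
lemma condEnt_sub_condEnt_le_of_condMutualInfo_lt {Ω β' γ : Type*} [MeasurableSpace Ω]
    [MeasurableSpace β'] [MeasurableSpace γ] [Fintype γ] [DiscreteMeasurableSpace γ]
    (μ : Measure Ω) [IsProbabilityMeasure μ] {U : Ω → α} {V : Ω → β'} {C : Ω → γ} {T : β' → β}
    (hU : Measurable U) (hV : Measurable V) (hC : Measurable C) (hT : Measurable T) {ε : ℝ}
    (h : condMutualInfo μ U V C < ENNReal.ofReal ε) :
    condEnt μ U C - condEnt μ U (fun ω => (T (V ω), C ω)) ≤ ε * log 2 := by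
  have hε : 0 < ε := ENNReal.ofReal_pos.1 (lt_of_le_of_lt bot_le h)
  have hlog : 0 < log 2 := log_pos one_lt_two
  set K : γ → ENNReal := fun c => klDiv ((μ[|C ⁻¹' {c}]).map fun ω => (U ω, V ω))
      (((μ[|C ⁻¹' {c}]).map U).prod ((μ[|C ⁻¹' {c}]).map V)) with hK
  have h1 : ∑ c, μ (C ⁻¹' {c}) * K c < ENNReal.ofReal (ε * log 2) := by
    rw [ENNReal.ofReal_mul hε.le]
    exact (ENNReal.div_lt_iff (Or.inl (ENNReal.ofReal_pos.2 hlog).ne')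
      (Or.inl ENNReal.ofReal_ne_top)).1 h
  have hfin : ∀ c, μ (C ⁻¹' {c}) * K c ≠ ⊤ := fun c =>
    ((single_le_sum (f := fun c => μ (C ⁻¹' {c}) * K c) (fun _ _ => bot_le)
      (mem_univ c)).trans_lt (h1.trans ENNReal.ofReal_lt_top)).ne
  have h2 : ∑ c, μ.real (C ⁻¹' {c}) * (K c).toReal ≤ ε * log 2 := by
    have := (ENNReal.toReal_lt_toReal (h1.trans ENNReal.ofReal_lt_top).ne
      ENNReal.ofReal_ne_top).2 h1
    rw [ENNReal.toReal_sum fun c _ => hfin c, ENNReal.toReal_ofReal (by positivity)] at this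
    simpa only [ENNReal.toReal_mul, ← measureReal_def] using this.le
  set W : Ω → β := fun ω => T (V ω) with hW
  have hWm : Measurable W := hT.comp hV
  have key : ∀ c, (ent fun u => μ.real {ω | U ω = u ∧ C ω = c}) -
      ∑' v, (ent fun u => μ.real {ω | U ω = u ∧ (W ω, C ω) = (v, c)}) ≤
      μ.real (C ⁻¹' {c}) * (K c).toReal := by
    intro c
    have hCm : MeasurableSet (C ⁻¹' {c}) := hC (measurableSet_singleton c)
    -- A null value of `C` has no conditional law, and both entropies vanish on it.
    by_cases hc : μ (C ⁻¹' {c}) = 0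
    · have e0 : ∀ p : Ω → Prop, (∀ ω, p ω → C ω = c) → μ.real {ω | p ω} = 0 := fun p hp => by
        rw [measureReal_def, measure_mono_null (s := {ω | p ω}) (fun ω hω => hp ω hω) hc]; rfl
      have e1 : ∀ u, μ.real {ω | U ω = u ∧ C ω = c} = 0 := fun u => e0 _ fun ω h => h.2
      have e2 : ∀ u v, μ.real {ω | U ω = u ∧ (W ω, C ω) = (v, c)} = 0 := fun u v =>
        e0 _ fun ω h => (Prod.ext_iff.1 h.2).2
      simp only [e1, e2, ent_zero, tsum_zero, sub_zero]
      positivity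
    have hc' : 0 < μ.real (C ⁻¹' {c}) := ENNReal.toReal_pos hc (measure_ne_top _ _)
    have hKc : K c ≠ ⊤ := fun h0 => hfin c (by rw [h0, ENNReal.mul_top hc])
    have : IsProbabilityMeasure (μ[|C ⁻¹' {c}]) := cond_isProbabilityMeasure hc
    set ρ := μ[|C ⁻¹' {c}] with hρ
    have hreal : ∀ p : Ω → Prop, ρ.real {ω | p ω} =
        (μ.real (C ⁻¹' {c}))⁻¹ * μ.real {ω | p ω ∧ C ω = c} := fun p => by
      rw [hρ, measureReal_def, cond_apply hCm, ENNReal.toReal_mul, ENNReal.toReal_inv]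
      congr 1; rw [← measureReal_def]; congr 1; ext ω; simp [and_comm]
    set P := ρ.map fun ω => (U ω, W ω) with hP
    have hUW : Measurable fun ω => (U ω, W ω) := hU.prodMk hWm
    have : IsProbabilityMeasure P := Measure.isProbabilityMeasure_map hUW.aemeasurable
    have hle : klDiv P ((P.map Prod.fst).prod (P.map Prod.snd)) ≤ K c := by
      have e1 : P = (ρ.map fun ω => (U ω, V ω)).map (Prod.map id T) := by
        rw [Measure.map_map (measurable_id.prodMap hT) (hU.prodMk hV)]; rfl
      have e2 : (P.map Prod.fst).prod (P.map Prod.snd) =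
          ((ρ.map U).prod (ρ.map V)).map (Prod.map id T) := by
        have := Measure.isProbabilityMeasure_map (μ := ρ) hU.aemeasurable
        have := Measure.isProbabilityMeasure_map (μ := ρ) hV.aemeasurable
        rw [← Measure.map_prod_map _ _ measurable_id hT, Measure.map_id, hP,
          Measure.map_map measurable_fst hUW, Measure.map_map measurable_snd hUW,
          Measure.map_map hT hV]
        rfl
      have := Measure.isProbabilityMeasure_map (μ := ρ) hU.aemeasurable
      have := Measure.isProbabilityMeasure_map (μ := ρ) hV.aemeasurable
      have := Measure.isProbabilityMeasure_map (μ := ρ) (hU.prodMk hV).aemeasurable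
      rw [e2, e1]
      exact klDiv_map_le _ _ (measurable_id.prodMap hT)
    have h3 := ent_sub_condEnt_le_klDiv P (ne_top_of_le_ne_top hKc hle)
    have h4 := h3.trans (ENNReal.toReal_mono hKc hle)
    have h5 : ∀ u, P.real {ω | ω.1 = u} =
        (μ.real (C ⁻¹' {c}))⁻¹ * μ.real {ω | U ω = u ∧ C ω = c} := fun u => by
      rw [← hreal, hP, map_measureReal_apply hUW MeasurableSet.of_discrete]; rfl
    have h6 : condEnt P Prod.fst Prod.snd = (μ.real (C ⁻¹' {c}))⁻¹ *
        ∑' v, (ent fun u => μ.real {ω | U ω = u ∧ (W ω, C ω) = (v, c)}) := by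
      rw [hP, condEnt_map ρ hUW, condEnt, ← tsum_mul_left]
      refine tsum_congr fun v => ?_
      rw [← ent_smul]
      congr 1 with u
      rw [hreal]
      simp only [Prod.mk.injEq, and_assoc]
    simp only [h5, ent_smul] at h4
    rw [h6, ← mul_sub, inv_mul_le_iff₀ hc'] at h4
    exact h4
  have h7 := (sum_le_sum fun c (_ : c ∈ univ) => key c).trans h2
  rw [sum_sub_distrib] at h7
  have hR : Measurable fun ω => (U ω, W ω, C ω) := hU.prodMk (hWm.prodMk hC)
  have := Measure.isProbabilityMeasure_map (μ := μ) hR.aemeasurable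
  have hs := summable_ent (μ.map fun ω => (U ω, W ω, C ω)) (fun x : α × β × γ => x.1)
    (fun x => x.2)
  simp only [map_measureReal_apply hR MeasurableSet.of_discrete] at hs
  have h8 : condEnt μ U (fun ω => (W ω, C ω)) =
      ∑ c, ∑' v, (ent fun u => μ.real {ω | U ω = u ∧ (W ω, C ω) = (v, c)}) := by
    rw [condEnt, ← (Equiv.prodComm γ β).tsum_eq, Summable.tsum_prod, tsum_fintype]
    · rfl
    · exact hs.prod_symm
  rw [h8, condEnt, tsum_fintype]
  exact h7

end

/-! ### Secure oblivious transfer runs with a factorized joint law -/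

section

variable {𝒳 𝒴 : Type*} [Fintype 𝒳] [Fintype 𝒴]
  [MeasurableSpace 𝒳] [DiscreteMeasurableSpace 𝒳]
  [MeasurableSpace 𝒴] [DiscreteMeasurableSpace 𝒴] {m n k : ℕ}

/-- The discrete random variables of a run: everything but the local randomness. -/
def Run.view (E : Run (Fin m → Bool) (Fin m) 𝒳 𝒴 (Fin 1) Bool n k) (ω : E.Ω) :
    (Fin k → Fin m → Bool) × (Fin k → Fin m) × (Fin n → 𝒳) × (Fin n → 𝒴) × (Fin k → Bool) ×
      (Fin E.r → ℕ) :=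
  (E.A ω, E.B ω, E.X ω, E.Y ω, E.Ghat ω, E.M ω)

lemma Run.measurable_view (E : Run (Fin m → Bool) (Fin m) 𝒳 𝒴 (Fin 1) Bool n k) :
    Measurable E.view :=
  E.measurable_A.prodMk (E.measurable_B.prodMk (E.measurable_X.prodMk (E.measurable_Y.prodMk
    (E.measurable_Ghat.prodMk E.measurable_M))))

/-- The joint law of the discrete random variables of a run factors into the correlation `w`, the
behaviour `α` of Alice and the behaviour `β` of Bob. -/
def Run.Factors (E : Run (Fin m → Bool) (Fin m) 𝒳 𝒴 (Fin 1) Bool n k)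
    (w : (Fin n → 𝒳) → (Fin n → 𝒴) → ℝ)
    (α : (Fin k → Fin m → Bool) → (Fin n → 𝒳) → (Fin E.r → ℕ) → ℝ)
    (β : (Fin k → Fin m) → (Fin n → 𝒴) → (Fin k → Bool) → (Fin E.r → ℕ) → ℝ) : Prop :=
  ∀ a b x y g τ, E.μ.real {ω | E.view ω = (a, b, x, y, g, τ)} =
    ((Fintype.card (Fin k → Fin m → Bool) : ℝ)⁻¹ * (Fintype.card (Fin k → Fin m) : ℝ)⁻¹) *
      w x y * α a x τ * β b y g τ

/-- The choice s = √ε balances the two error terms of the Pinsker estimate. -/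
lemma delta_le {ε : ℝ} (hε : 0 < ε) : ε * log 2 / (2 * √ε) + 2 * √ε ≤ 3 * √ε := by
  have h1 : 0 < √ε := sqrt_pos.2 hε
  have h2 : ε * log 2 / (2 * √ε) ≤ √ε := by
    rw [div_le_iff₀ (by positivity)]
    have h3 : log 2 ≤ 1 := by linarith [log_le_sub_one_of_pos (x := 2) two_pos]
    nlinarith [mul_self_sqrt hε.le]
  linarith

/-- The run is replaced by the law of its `view`, a discrete space on which the entropy calculus
applies. The weights `s` and `t` stay free because the two models use different ones. -/
theorem Run.bounds_of_isSecure (E : Run (Fin m → Bool) (Fin m) 𝒳 𝒴 (Fin 1) Bool n k)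
    (hm : 2 ≤ m) {ε : ℝ} (hE : E.IsSecure (otF m) (otG m) ε)
    (hAB : ∀ a b, E.μ.real {ω | E.A ω = a ∧ E.B ω = b} =
      (Fintype.card (Fin k → Fin m → Bool) : ℝ)⁻¹ * (Fintype.card (Fin k → Fin m) : ℝ)⁻¹)
    {w : (Fin n → 𝒳) → (Fin n → 𝒴) → ℝ} {s : (Fin n → 𝒳) → ℝ} {t : (Fin n → 𝒴) → ℝ}
    {α : (Fin k → Fin m → Bool) → (Fin n → 𝒳) → (Fin E.r → ℕ) → ℝ}
    {β : (Fin k → Fin m) → (Fin n → 𝒴) → (Fin k → Bool) → (Fin E.r → ℕ) → ℝ}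
    (hfac : E.Factors w α β) (hw : ∀ x y, 0 ≤ w x y) (hα : ∀ a x τ, 0 ≤ α a x τ)
    (hβ : ∀ b y g τ, 0 ≤ β b y g τ) (hs : ∀ x, 0 ≤ s x) (ht : ∀ y, 0 ≤ t y)
    (hst : ∀ x y, E.μ.real {ω | E.X ω = x ∧ E.Y ω = y} ≠ 0 → s x ≠ 0 ∧ t y ≠ 0)
    (href : ∀ (a : Fin k → Fin m → Bool) (b : Fin k → Fin m) (F : Finset (Fin E.r → ℕ)),
      ∑ τ ∈ F, ∑ x, ∑ y, ∑ g, s x * t y * α a x τ * β b y g τ ≤ 1) :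
    (k * log 2 - ε * log 2 - 2 * (3 * √ε * (k * log 2) + log 2) - (ε * (k * log 2) + log 2) ≤
      ∑ x, ∑ y, E.μ.real {ω | E.X ω = x ∧ E.Y ω = y} *
        (log (w x y) - log (s x) - log (t y))) ∧
    ((m - 1) * (k * log 2) - ε * log 2 ≤ condEnt E.μ E.X E.Y +
      m * ((ε * (k * log 2) + log 2) + (3 * √ε * (k * log 2) + log 2))) := by
  have hε : 0 < ε := ENNReal.ofReal_pos.1 (lt_of_le_of_lt bot_le hE.correct_G)
  have : NeZero m := ⟨by omega⟩
  set c := (Fintype.card (Fin k → Fin m → Bool) : ℝ)⁻¹ * (Fintype.card (Fin k → Fin m) : ℝ)⁻¹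
    with hc
  have hc0 : 0 < c := by
    have h1 : 0 < (Fintype.card (Fin k → Fin m → Bool) : ℝ) := Nat.cast_pos.2 Fintype.card_pos
    have h2 : 0 < (Fintype.card (Fin k → Fin m) : ℝ) := Nat.cast_pos.2 Fintype.card_pos
    positivity
  have hv := E.measurable_view
  set P := E.μ.map E.view with hP
  have : IsProbabilityMeasure P := Measure.isProbabilityMeasure_map hv.aemeasurable
  have hreal : ∀ p : _ → Prop, P.real {d | p d} = E.μ.real {ω | p (E.view ω)} := fun p => by
    rw [hP, map_measureReal_apply hv MeasurableSet.of_discrete]; rfl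
  set A : (Fin k → Fin m → Bool) × (Fin k → Fin m) × (Fin n → 𝒳) × (Fin n → 𝒴) × (Fin k → Bool) ×
      (Fin E.r → ℕ) → _ := fun d => d.1 with hA
  set B : (Fin k → Fin m → Bool) × (Fin k → Fin m) × (Fin n → 𝒳) × (Fin n → 𝒴) × (Fin k → Bool) ×
      (Fin E.r → ℕ) → _ := fun d => d.2.1 with hB
  set X : (Fin k → Fin m → Bool) × (Fin k → Fin m) × (Fin n → 𝒳) × (Fin n → 𝒴) × (Fin k → Bool) ×
      (Fin E.r → ℕ) → _ := fun d => d.2.2.1 with hX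
  set Y : (Fin k → Fin m → Bool) × (Fin k → Fin m) × (Fin n → 𝒳) × (Fin n → 𝒴) × (Fin k → Bool) ×
      (Fin E.r → ℕ) → _ := fun d => d.2.2.2.1 with hY
  set Gh : (Fin k → Fin m → Bool) × (Fin k → Fin m) × (Fin n → 𝒳) × (Fin n → 𝒴) ×
      (Fin k → Bool) × (Fin E.r → ℕ) → _ := fun d => d.2.2.2.2.1 with hGh
  set M : (Fin k → Fin m → Bool) × (Fin k → Fin m) × (Fin n → 𝒳) × (Fin n → 𝒴) × (Fin k → Bool) ×
      (Fin E.r → ℕ) → _ := fun d => d.2.2.2.2.2 with hM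
  set G : (Fin k → Fin m → Bool) × (Fin k → Fin m) × (Fin n → 𝒳) × (Fin n → 𝒴) × (Fin k → Bool) ×
      (Fin E.r → ℕ) → Fin k → Bool := fun d i => d.1 i (d.2.1 i) with hGd
  have hGm : Measurable (E.G (otG m)) := by
    have : E.G (otG m) = G ∘ E.view := rfl
    rw [this]; exact (Measurable.of_discrete).comp hv
  have hFm : Measurable (E.F (otF m)) := measurable_const' fun _ _ => Subsingleton.elim _ _
  have hG : ∀ d, G d = selectBits 0 (B d) (A d) := fun d => by
    funext i; simp [G, selectBits, A, B]
  have hAB' : ∀ a b, P.real {d | A d = a ∧ B d = b} = c := fun a b => by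
    rw [hreal]; exact hAB a b
  have hη : condEnt P A (fun d => (B d, G d)) -
      condEnt P A (fun d => ((Y d, M d), (B d, G d))) ≤ ε * log 2 := by
    rw [hP, condEnt_map _ hv, condEnt_map _ hv]
    exact condEnt_sub_condEnt_le_of_condMutualInfo_lt E.μ (T := Prod.snd) E.measurable_A
      (E.measurable_ZB.prodMk (E.measurable_Y.prodMk E.measurable_M))
      (E.measurable_B.prodMk hGm) measurable_snd hE.alice_private
  have hη' : condEnt P B A - condEnt P B (fun d => ((X d, M d), A d)) ≤ ε * log 2 := by
    -- Alice's function is constant and can be dropped from the condition.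
    have h1 : condEnt P B (fun d => (A d, fun _ : Fin k => (0 : Fin 1))) -
      condEnt P B (fun d => ((X d, M d), (A d, fun _ : Fin k => (0 : Fin 1)))) ≤ ε * log 2 := by
      rw [hP, condEnt_map _ hv, condEnt_map _ hv]
      exact condEnt_sub_condEnt_le_of_condMutualInfo_lt E.μ (T := Prod.snd) E.measurable_B
        (E.measurable_ZA.prodMk (E.measurable_X.prodMk E.measurable_M))
        (E.measurable_A.prodMk hFm) measurable_snd hE.bob_private
    rw [condEnt_congr_right P B (V' := A) Prod.fst (fun a => (a, fun _ => 0)) (fun _ => rfl)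
      (fun _ => rfl), condEnt_congr_right P B (V' := fun d => ((X d, M d), A d))
      (fun v => (v.1, v.2.1)) (fun v => (v.1, (v.2, fun _ => 0))) (fun _ => rfl)
      (fun _ => rfl)] at h1
    exact h1
  have hεG : P.real {d | Gh d ≠ G d} ≤ ε := by
    rw [hreal]
    exact ENNReal.toReal_le_of_le_ofReal hε.le hE.correct_G.le
  have hδ := delta_le hε
  have hlog : 0 ≤ log 2 := log_nonneg one_le_two
  have hfac' : ∀ (u : (Fin k → Fin m → Bool) × (Fin n → 𝒳))
      (v : (Fin k → Fin m) × (Fin n → 𝒴) × (Fin k → Bool)) τ,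
      P.real {d | (A d, X d) = u ∧ (B d, Y d, Gh d) = v ∧ M d = τ} =
        c * w u.2 v.2.1 * α u.1 u.2 τ * β v.1 v.2.1 v.2.2 τ := by
    rintro ⟨a, x⟩ ⟨b, y, g⟩ τ
    rw [hreal, ← hfac a b x y g τ]
    congr 1; ext ω
    simp only [Set.mem_ofPred_eq, Prod.ext_iff, A, B, X, Y, Gh, M]
    tauto
  have hXY : ∀ x y, P.real {d | X d = x ∧ Y d = y} = E.μ.real {ω | E.X ω = x ∧ E.Y ω = y} :=
    fun x y => hreal _
  constructor
  · have h1 := rate_le_shared_info P (X := X) (Ghat := Gh) hG hAB' hη hη' hεG (sqrt_pos.2 hε) hm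
    have hmono : ∀ (u : (Fin k → Fin m → Bool) × (Fin n → 𝒳))
        (v : (Fin k → Fin m) × (Fin n → 𝒴) × (Fin k → Bool)),
        P.real {d | (A d, X d) = u ∧ (B d, Y d, Gh d) = v} ≠ 0 →
        P.real {d | X d = u.2 ∧ Y d = v.2.1} ≠ 0 := fun u v h h0 => h <|
      le_antisymm (h0 ▸ measureReal_mono fun d hd => by
        simp only [Set.mem_ofPred_eq, Prod.ext_iff] at hd ⊢; tauto) measureReal_nonneg
    -- The uniform weight `c` goes into both `w` and `s`: it cancels in the logarithms and makes the
    -- reference mass an average of the masses in `href` over `(a, b)`.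
    have h2 := condEnt_sub_condEnt_le P (fun d => (A d, X d)) (fun d => (B d, Y d, Gh d)) M
      (w := fun u v => c * w u.2 v.2.1) (s := fun u => c * s u.2) (t := fun v => t v.2.1)
      (α := fun u τ => α u.1 u.2 τ) (β := fun v τ => β v.1 v.2.1 v.2.2 τ) hfac'
      (fun u v => mul_nonneg hc0.le (hw _ _)) (fun u τ => hα _ _ _) (fun v τ => hβ _ _ _ _)
      (fun u => mul_nonneg hc0.le (hs _)) (fun v => ht _)
      (fun u v h => by
        have := hst u.2 v.2.1 (by rw [← hXY]; exact hmono u v h)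
        exact ⟨mul_ne_zero hc0.ne' this.1, this.2⟩) ?_
    · have h3 : ∑ u : (Fin k → Fin m → Bool) × (Fin n → 𝒳),
          ∑ v : (Fin k → Fin m) × (Fin n → 𝒴) × (Fin k → Bool),
          P.real {d | (A d, X d) = u ∧ (B d, Y d, Gh d) = v} *
            (log (c * w u.2 v.2.1) - log (c * s u.2) - log (t v.2.1)) =
          ∑ x, ∑ y, E.μ.real {ω | E.X ω = x ∧ E.Y ω = y} *
            (log (w x y) - log (s x) - log (t y)) := by
        have e1 : ∀ u v, P.real {d | (A d, X d) = u ∧ (B d, Y d, Gh d) = v} *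
            (log (c * w u.2 v.2.1) - log (c * s u.2) - log (t v.2.1)) =
            P.real {d | (A d, X d) = u ∧ (B d, Y d, Gh d) = v} *
            (log (w u.2 v.2.1) - log (s u.2) - log (t v.2.1)) := by
          intro u v
          by_cases h0 : P.real {d | (A d, X d) = u ∧ (B d, Y d, Gh d) = v} = 0
          · simp only [h0, zero_mul]
          have hs0 := (hst u.2 v.2.1 (by rw [← hXY]; exact hmono u v h0)).1
          have hw0 : w u.2 v.2.1 ≠ 0 := fun hw0 => h0 <| by
            have e := hasSum_measureReal_and P
              (fun d => (A d, X d) = u ∧ (B d, Y d, Gh d) = v) M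
            simp only [and_assoc, hfac', hw0, mul_zero, zero_mul] at e
            exact e.unique hasSum_zero
          rw [log_mul hc0.ne' hw0, log_mul hc0.ne' hs0]
          ring
        simp only [e1, Fintype.sum_prod_type]
        rw [sum_comm]
        refine sum_congr rfl fun x _ => ?_
        have e2 : ∀ y, E.μ.real {ω | E.X ω = x ∧ E.Y ω = y} = ∑ a, ∑ b, ∑ g,
            P.real {d | (A d, X d) = (a, x) ∧ (B d, Y d, Gh d) = (b, y, g)} := fun y => by
          rw [← hXY, ← sum_measureReal_and P _ A]
          refine sum_congr rfl fun a _ => ?_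
          rw [← sum_measureReal_and P _ B]
          refine sum_congr rfl fun b _ => ?_
          rw [← sum_measureReal_and P _ Gh]
          refine sum_congr rfl fun g _ => congrArg _ (Set.ext fun d => ?_)
          simp only [Set.mem_ofPred_eq, Prod.mk.injEq]
          tauto
        simp only [e2, sum_mul]
        rw [sum_comm (t := (univ : Finset (Fin k → Fin m → Bool)))]
        refine sum_congr rfl fun a _ => ?_
        rw [sum_comm]
      have h4 : (ε * log 2 / (2 * √ε) + 2 * √ε) * (k * log 2) ≤ 3 * √ε * (k * log 2) := by
        gcongr
      linarith
    · intro F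
      have e1 : ∑ τ ∈ F, ∑ u : (Fin k → Fin m → Bool) × (Fin n → 𝒳),
          ∑ v : (Fin k → Fin m) × (Fin n → 𝒴) × (Fin k → Bool),
          c * s u.2 * t v.2.1 * α u.1 u.2 τ * β v.1 v.2.1 v.2.2 τ =
          ∑ a, ∑ b, c * ∑ τ ∈ F, ∑ x, ∑ y, ∑ g, s x * t y * α a x τ * β b y g τ := by
        simp only [Fintype.sum_prod_type, mul_sum]
        rw [sum_comm]
        refine sum_congr rfl fun a _ => ?_
        rw [sum_comm (s := univ)]
        refine sum_congr rfl fun τ _ => ?_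
        rw [sum_comm]
        refine sum_congr rfl fun b _ => sum_congr rfl fun x _ => sum_congr rfl fun y _ =>
          sum_congr rfl fun g _ => by ring
      rw [e1]
      calc _ ≤ ∑ a : Fin k → Fin m → Bool, ∑ b : Fin k → Fin m, c * 1 :=
            sum_le_sum fun a _ => sum_le_sum fun b _ =>
              mul_le_mul_of_nonneg_left (href a b F) hc0.le
        _ = 1 := by
            simp only [sum_const, card_univ, nsmul_eq_mul, hc, mul_one]
            have h1 : (Fintype.card (Fin k → Fin m → Bool) : ℝ) ≠ 0 :=
              Nat.cast_ne_zero.2 Fintype.card_ne_zero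
            have h2 : (Fintype.card (Fin k → Fin m) : ℝ) ≠ 0 :=
              Nat.cast_ne_zero.2 Fintype.card_ne_zero
            field_simp
  · have h1 := rate_le_condEnt P hG hAB' hη hη' hεG (sqrt_pos.2 hε)
      (f := α) (g := fun b gh x τ => ∑ y, c * w x y * β b y gh τ) ?_
    · have h4 : (ε * log 2 / (2 * √ε) + 2 * √ε) * (k * log 2) ≤ 3 * √ε * (k * log 2) := by
        gcongr
      have h5 : condEnt P X Y = condEnt E.μ E.X E.Y := by rw [hP, condEnt_map _ hv]; rfl
      rw [h5] at h1
      refine h1.trans ?_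
      gcongr
    · intro a x b gh τ
      rw [← sum_measureReal_and P _ Y, mul_sum]
      refine sum_congr rfl fun y _ => ?_
      have := hfac' (a, x) (b, y, gh) τ
      refine Eq.trans (congrArg _ (Set.ext fun d => ?_)) (this.trans (by ring))
      simp only [Set.mem_ofPred_eq, Prod.mk.injEq]
      tauto

end

/-! ### Single-letterization -/

lemma sum_measureReal_mul_comp {D ζ ξ : Type*} [MeasurableSpace D] [DiscreteMeasurableSpace D]
    (μ : Measure D) [IsFiniteMeasure μ] [Fintype ζ] [Fintype ξ] (Z : D → ζ) (g : ζ → ξ)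
    (f : ξ → ℝ) :
    ∑ z, μ.real {ω | Z ω = z} * f (g z) = ∑ c, μ.real {ω | g (Z ω) = c} * f c := by
  classical
  have h : ∀ c, μ.real {ω | g (Z ω) = c} =
      ∑ z, if g z = c then μ.real {ω | Z ω = z} else 0 := fun c => by
    simpa using sum_measureReal_and_eq μ (fun _ => True) Z g c
  simp only [h, sum_mul]
  rw [sum_comm]
  simp [ite_mul]

section

variable {𝒳 𝒴 : Type*} [Fintype 𝒳] [Fintype 𝒴]

lemma margX_nonneg (P : PMF (𝒳 × 𝒴)) (x : 𝒳) : 0 ≤ margX P x :=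
  sum_nonneg fun _ _ => ENNReal.toReal_nonneg

lemma margY_nonneg (P : PMF (𝒳 × 𝒴)) (y : 𝒴) : 0 ≤ margY P y :=
  sum_nonneg fun _ _ => ENNReal.toReal_nonneg

lemma margX_ne_zero {P : PMF (𝒳 × 𝒴)} {x : 𝒳} {y : 𝒴} (h : (P (x, y)).toReal ≠ 0) :
    margX P x ≠ 0 := fun h0 => h <|
  (sum_eq_zero_iff_of_nonneg fun _ _ => ENNReal.toReal_nonneg).1 h0 y (mem_univ _)

lemma margY_ne_zero {P : PMF (𝒳 × 𝒴)} {x : 𝒳} {y : 𝒴} (h : (P (x, y)).toReal ≠ 0) :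
    margY P y ≠ 0 := fun h0 => h <|
  (sum_eq_zero_iff_of_nonneg fun _ _ => ENNReal.toReal_nonneg).1 h0 x (mem_univ _)

lemma sum_toReal_pmf {ζ : Type*} [Fintype ζ] (P : PMF ζ) : ∑ z, (P z).toReal = 1 := by
  rw [← ENNReal.toReal_sum fun z _ => P.apply_ne_top z, ← tsum_fintype (L := .unconditional _),
    P.tsum_coe, ENNReal.toReal_one]

lemma sum_margX (P : PMF (𝒳 × 𝒴)) : ∑ x, margX P x = 1 := by
  rw [← sum_toReal_pmf P, Fintype.sum_prod_type]; rfl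

lemma sum_margY (P : PMF (𝒳 × 𝒴)) : ∑ y, margY P y = 1 := by
  rw [← sum_toReal_pmf P, Fintype.sum_prod_type_right]; rfl

lemma mutualInfo_mul_log (P : PMF (𝒳 × 𝒴)) :
    mutualInfo P * log 2 = ∑ x, ∑ y, (P (x, y)).toReal *
      (log (P (x, y)).toReal - log (margX P x) - log (margY P y)) := by
  have h2 : log 2 ≠ 0 := (log_pos one_lt_two).ne'
  simp only [mutualInfo, sum_mul]
  refine sum_congr rfl fun x _ => sum_congr rfl fun y _ => ?_
  by_cases h : (P (x, y)).toReal = 0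
  · simp [h]
  rw [logb, log_div h (mul_ne_zero (margX_ne_zero h) (margY_ne_zero h)),
    log_mul (margX_ne_zero h) (margY_ne_zero h)]
  field_simp
  ring

lemma condEntropy_mul_log (P : PMF (𝒳 × 𝒴)) :
    condEntropy P * log 2 = ∑ y, ent fun x => (P (x, y)).toReal := by
  have h2 : log 2 ≠ 0 := (log_pos one_lt_two).ne'
  simp only [condEntropy, neg_mul, sum_mul]
  rw [sum_comm, ← sum_neg_distrib]
  refine sum_congr rfl fun y _ => ?_
  rw [ent_eq_sum, ← sum_neg_distrib]
  refine sum_congr rfl fun x _ => ?_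
  by_cases h : (P (x, y)).toReal = 0
  · simp [h]
  rw [logb, log_div h (margY_ne_zero h), margY]
  field_simp
  ring

/-- In the form H(Y) - H(Y|X), mutual information is a concave function of the input law minus a
linear one. -/
lemma mutualInfo_mul_log_eq_ent (P : PMF (𝒳 × 𝒴)) :
    mutualInfo P * log 2 =
      ent (fun y => ∑ x, (P (x, y)).toReal) - ∑ x, ent fun y => (P (x, y)).toReal := by
  rw [mutualInfo_mul_log]
  have h1 : ent (fun y => ∑ x, (P (x, y)).toReal) =
      ∑ x, ∑ y, (P (x, y)).toReal * (- log (margY P y)) := by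
    rw [sum_comm, ent_eq_sum]
    have : ∑ y, ∑ x, (P (x, y)).toReal = 1 := sum_margY P
    refine sum_congr rfl fun y _ => ?_
    rw [this, log_one, zero_sub, sum_mul]; rfl
  rw [h1, ← sum_sub_distrib]
  refine sum_congr rfl fun x _ => ?_
  rw [ent_eq_sum, ← sum_sub_distrib]
  refine sum_congr rfl fun y _ => ?_
  rw [margX]
  ring

variable {Ω : Type*} [MeasurableSpace Ω] (μ : Measure Ω) [IsProbabilityMeasure μ]
  [MeasurableSpace 𝒳] [DiscreteMeasurableSpace 𝒳]
  [MeasurableSpace 𝒴] [DiscreteMeasurableSpace 𝒴] {n : ℕ}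
  {X : Ω → Fin n → 𝒳} {Y : Ω → Fin n → 𝒴}

/-- For product weights the log ratio is additive, so only the laws of the single pairs `(X i, Y i)`
matter, even if the pairs are dependent. -/
lemma sum_measureReal_log_prod (hX : Measurable X) (hY : Measurable Y) {w : 𝒳 → 𝒴 → ℝ}
    {s : Fin n → 𝒳 → ℝ} {t : Fin n → 𝒴 → ℝ}
    (h : ∀ x y, μ.real {ω | X ω = x ∧ Y ω = y} ≠ 0 →
      ∀ i, w (x i) (y i) ≠ 0 ∧ s i (x i) ≠ 0 ∧ t i (y i) ≠ 0) :
    ∑ x, ∑ y, μ.real {ω | X ω = x ∧ Y ω = y} * (log (∏ i, w (x i) (y i)) -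
        log (∏ i, s i (x i)) - log (∏ i, t i (y i))) =
      ∑ i, ∑ x, ∑ y, μ.real {ω | X ω i = x ∧ Y ω i = y} *
        (log (w x y) - log (s i x) - log (t i y)) := by
  have hXY : Measurable fun ω => (X ω, Y ω) := hX.prodMk hY
  have hP := Measure.isProbabilityMeasure_map (μ := μ) hXY.aemeasurable
  have h1 : ∀ x y, μ.real {ω | X ω = x ∧ Y ω = y} * (log (∏ i, w (x i) (y i)) -
        log (∏ i, s i (x i)) - log (∏ i, t i (y i))) =
      ∑ i, μ.real {ω | X ω = x ∧ Y ω = y} *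
        (log (w (x i) (y i)) - log (s i (x i)) - log (t i (y i))) := by
    intro x y
    by_cases h0 : μ.real {ω | X ω = x ∧ Y ω = y} = 0
    · simp [h0]
    rw [log_prod fun i _ => (h x y h0 i).1, log_prod fun i _ => (h x y h0 i).2.1,
      log_prod fun i _ => (h x y h0 i).2.2, ← mul_sum, sum_sub_distrib, sum_sub_distrib]
  simp only [h1]
  have h2 : ∀ f : Fin n → 𝒳 × 𝒴 → ℝ, ∀ i,
      ∑ x, ∑ y, μ.real {ω | X ω = x ∧ Y ω = y} * f i (x i, y i) =
      ∑ x, ∑ y, μ.real {ω | X ω i = x ∧ Y ω i = y} * f i (x, y) := by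
    intro f i
    have := sum_measureReal_mul_comp (μ.map fun ω => (X ω, Y ω)) id
      (fun z => (z.1 i, z.2 i)) (f i)
    simp only [map_measureReal_apply hXY MeasurableSet.of_discrete, Fintype.sum_prod_type,
      id, Set.preimage_ofPred_eq, Prod.mk.injEq] at this
    exact this
  have h3 := fun i => h2 (fun i z => log (w z.1 z.2) - log (s i z.1) - log (t i z.2)) i
  simp only at h3
  simp only [← h3]
  rw [sum_comm (s := (univ : Finset (Fin n)))]
  exact sum_congr rfl fun x _ => sum_comm

lemma condEnt_le_sum_coord (hX : Measurable X) (hY : Measurable Y) :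
    condEnt μ X Y ≤ ∑ i, ∑ y, ent fun x => μ.real {ω | X ω i = x ∧ Y ω i = y} := by
  have hXY : Measurable fun ω => (X ω, Y ω) := hX.prodMk hY
  have hP := Measure.isProbabilityMeasure_map (μ := μ) hXY.aemeasurable
  have h1 := condEnt_map μ hXY Prod.fst Prod.snd
  have h2 := condEnt_pi_le (μ.map fun ω => (X ω, Y ω)) Prod.snd (fun i z => z.1 i)
  rw [show (fun (z : (Fin n → 𝒳) × (Fin n → 𝒴)) i => z.1 i) = Prod.fst from rfl, h1] at h2
  refine h2.trans (sum_le_sum fun i _ => ?_)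
  refine (condEnt_mono_right _ _ (V' := fun z => z.2 i) (fun y => y i) fun _ => rfl).trans_eq ?_
  rw [condEnt_map μ hXY, condEnt, tsum_fintype]

end

/-! ### Source model -/

lemma transcript_ext {r : ℕ} {τ τ' : Fin r → ℕ}
    (h : ∀ j : Fin r, (∀ l : Fin r, (l : ℕ) < j → τ l = τ' l) → τ j = τ' j) : τ = τ' := by
  have : ∀ N, ∀ j : Fin r, (j : ℕ) < N → τ j = τ' j := by
    intro N
    induction N with
    | zero => intro j hj; omega
    | succ N ih => exact fun j hj => h j fun l hl => ih l (by omega)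
  exact funext fun j => this r j j.2

/-- The rectangles `S i ×ˢ T i` are pairwise disjoint in the product of the two randomness spaces.
-/
lemma sum_measureReal_mul_le_one {𝒵 𝒵' ι : Type*} [MeasurableSpace 𝒵] [MeasurableSpace 𝒵']
    (ν : Measure 𝒵) (ν' : Measure 𝒵') [IsProbabilityMeasure ν] [IsProbabilityMeasure ν']
    (F : Finset ι) (S : ι → Set 𝒵) (T : ι → Set 𝒵') (hS : ∀ i, MeasurableSet (S i))
    (hT : ∀ i, MeasurableSet (T i))
    (h : ∀ i j z z', z ∈ S i → z ∈ S j → z' ∈ T i → z' ∈ T j → i = j) :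
    ∑ i ∈ F, ν.real (S i) * ν'.real (T i) ≤ 1 := by
  simp only [← measureReal_prod_prod]
  rw [← probReal_univ (μ := ν.prod ν')]
  refine sum_measureReal_le_measureReal_univ (fun i _ => (hS i).prod (hT i)) ?_
  intro i _ j _ hij
  exact Set.disjoint_left.2 fun z hz hz' => hij (h i j z.1 z.2 hz.1 hz'.1 hz.2 hz'.2)

lemma uniformSource_singleton {m k : ℕ} [NeZero m] (a : Fin k → Fin m → Bool)
    (b : Fin k → Fin m) : (uniformSource m k).real {(a, b)} =
      (Fintype.card (Fin k → Fin m → Bool) : ℝ)⁻¹ * (Fintype.card (Fin k → Fin m) : ℝ)⁻¹ := by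
  rw [uniformSource, measureReal_def, uniformOn_univ, Measure.count_singleton, Fintype.card_prod,
    Nat.cast_mul, ENNReal.toReal_div, ENNReal.toReal_mul, mul_comm]
  simp [mul_comm]

section

variable {𝒳 𝒴 : Type*} [Fintype 𝒳] [Fintype 𝒴]
  [MeasurableSpace 𝒳] [DiscreteMeasurableSpace 𝒳]
  [MeasurableSpace 𝒴] [DiscreteMeasurableSpace 𝒴] {m n k : ℕ}

lemma sum_prod_eq_one {ζ : Type*} [Fintype ζ] (f : Fin n → ζ → ℝ) (hf : ∀ i, ∑ z, f i z = 1) :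
    ∑ z : Fin n → ζ, ∏ i, f i (z i) = 1 := by
  classical
  have := Finset.prod_univ_sum (fun _ : Fin n => (univ : Finset ζ)) f
  rw [Fintype.piFinset_univ] at this
  rw [← this]
  exact prod_eq_one fun i _ => hf i

lemma Run.IsSourceModel.measureReal_eq [NeZero m]
    {E : Run (Fin m → Bool) (Fin m) 𝒳 𝒴 (Fin 1) Bool n k} {P : PMF (𝒳 × 𝒴)}
    (hE : E.IsSourceModel (uniformSource m k) P) (Q : Set ((Fin k → Fin m → Bool) × (Fin k → Fin m)))
    (R : Set (Fin n → 𝒳 × 𝒴)) {S : Set E.𝒵A} {T : Set E.𝒵B} (hS : MeasurableSet S)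
    (hT : MeasurableSet T) :
    E.μ.real {ω | (E.A ω, E.B ω) ∈ Q ∧ (fun i => (E.X ω i, E.Y ω i)) ∈ R ∧ E.ZA ω ∈ S ∧
      E.ZB ω ∈ T} = (uniformSource m k).real Q *
      ((Measure.pi fun _ : Fin n => P.toMeasure).real R *
        ((E.μ.map E.ZA).real S * (E.μ.map E.ZB).real T)) := by
  have hf : Measurable fun ω => ((E.A ω, E.B ω), (fun i => (E.X ω i, E.Y ω i)), E.ZA ω, E.ZB ω) :=
    (E.measurable_A.prodMk E.measurable_B).prodMk (Measurable.prodMk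
      (measurable_pi_lambda _ fun i => ((measurable_pi_apply i).comp E.measurable_X).prodMk
        ((measurable_pi_apply i).comp E.measurable_Y))
      (E.measurable_ZA.prodMk E.measurable_ZB))
  have h1 := Measure.isProbabilityMeasure_map (μ := E.μ) E.measurable_ZA.aemeasurable
  have h2 := Measure.isProbabilityMeasure_map (μ := E.μ) E.measurable_ZB.aemeasurable
  rw [← measureReal_prod_prod, ← measureReal_prod_prod, ← measureReal_prod_prod, ← hE.law,
    map_measureReal_apply hf (MeasurableSet.of_discrete.prod (MeasurableSet.of_discrete.prod
      (hS.prod hT)))]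
  rfl

lemma pi_toMeasure_real_singleton (P : PMF (𝒳 × 𝒴)) (x : Fin n → 𝒳) (y : Fin n → 𝒴) :
    (Measure.pi fun _ : Fin n => P.toMeasure).real {fun i => (x i, y i)} =
      ∏ i, (P (x i, y i)).toReal := by
  rw [measureReal_def, Measure.pi_singleton, ENNReal.toReal_prod]
  refine prod_congr rfl fun i _ => ?_
  rw [PMF.toMeasure_apply_singleton _ _ (measurableSet_singleton _)]

/-- The reference weights are the marginals of `P`, as if the protocol were run on independent X^n
and Y^n; the expected log ratio is then n I(X;Y). -/
theorem Run.IsSourceModel.bounds (hm : 2 ≤ m)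
    {E : Run (Fin m → Bool) (Fin m) 𝒳 𝒴 (Fin 1) Bool n k} {P : PMF (𝒳 × 𝒴)}
    (hE : E.IsSourceModel (uniformSource m k) P) {ε : ℝ} (hsec : E.IsSecure (otF m) (otG m) ε) :
    (k * log 2 - ε * log 2 - 2 * (3 * √ε * (k * log 2) + log 2) - (ε * (k * log 2) + log 2) ≤
      n * (mutualInfo P * log 2)) ∧
    ((m - 1) * (k * log 2) - ε * log 2 ≤ n * (condEntropy P * log 2) +
      m * ((ε * (k * log 2) + log 2) + (3 * √ε * (k * log 2) + log 2))) := by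
  have : NeZero m := ⟨by omega⟩
  have hpA := Measure.isProbabilityMeasure_map (μ := E.μ) E.measurable_ZA.aemeasurable
  have hpB := Measure.isProbabilityMeasure_map (μ := E.μ) E.measurable_ZB.aemeasurable
  have hU : IsProbabilityMeasure (uniformSource m k) := by unfold uniformSource; infer_instance
  choose φ hφm hφ using hE.alice_msg
  choose ψ hψm hψ using hE.bob_msg
  obtain ⟨γ, hγm, hγ⟩ := hE.outputs.2
  -- `S` and `T` collect the local randomness of Alice and of Bob consistent with a transcript. That
  -- the transcript occurs is the rectangle `S × T`, whence the factorization.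
  set S : (Fin k → Fin m → Bool) → (Fin n → 𝒳) → (Fin E.r → ℕ) → Set E.𝒵A := fun a x τ =>
    {z | ∀ (j : Fin E.r) (hj : Even (j : ℕ)), φ j hj (a, x, z, fun l => τ l) = τ j} with hS
  set T : (Fin k → Fin m) → (Fin n → 𝒴) → (Fin k → Bool) → (Fin E.r → ℕ) → Set E.𝒵B :=
    fun b y g τ => {z | (∀ (j : Fin E.r) (hj : Odd (j : ℕ)), ψ j hj (b, y, z, fun l => τ l) = τ j) ∧
      γ (b, y, z, τ) = g} with hT
  have hSm : ∀ a x τ, MeasurableSet (S a x τ) := fun a x τ => by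
    have : S a x τ = ⋂ (j : Fin E.r) (hj : Even (j : ℕ)),
        (fun z => φ j hj (a, x, z, fun l => τ l)) ⁻¹' {τ j} := by ext; simp [S]
    rw [this]
    exact MeasurableSet.iInter fun j => MeasurableSet.iInter fun hj =>
      ((hφm j hj).comp (by fun_prop)) (measurableSet_singleton _)
  have hTm : ∀ b y g τ, MeasurableSet (T b y g τ) := fun b y g τ => by
    have : T b y g τ = (⋂ (j : Fin E.r) (hj : Odd (j : ℕ)),
        (fun z => ψ j hj (b, y, z, fun l => τ l)) ⁻¹' {τ j}) ∩
        (fun z => γ (b, y, z, τ)) ⁻¹' {g} := by ext; simp [T]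
    rw [this]
    exact (MeasurableSet.iInter fun j => MeasurableSet.iInter fun hj =>
      ((hψm j hj).comp (by fun_prop)) (measurableSet_singleton _)).inter
      ((hγm.comp (by fun_prop)) (measurableSet_singleton _))
  have huniq : ∀ a b x y g g' τ τ' z z', z ∈ S a x τ → z ∈ S a x τ' → z' ∈ T b y g τ →
      z' ∈ T b y g' τ' → τ = τ' ∧ g = g' := by
    intro a b x y g g' τ τ' z z' h1 h2 h3 h4
    have h : τ = τ' := transcript_ext fun j hj => by
      have hl : (fun l : {l : Fin E.r // (l : ℕ) < j} => τ l) = fun l => τ' l.1 :=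
        funext fun l => hj l l.2
      rcases Nat.even_or_odd (j : ℕ) with he | ho
      · rw [← h1 j he, ← h2 j he, hl]
      · rw [← h3.1 j ho, ← h4.1 j ho, hl]
    subst h
    exact ⟨rfl, h3.2.symm.trans h4.2⟩
  have hAB : ∀ a b, E.μ.real {ω | E.A ω = a ∧ E.B ω = b} =
      (Fintype.card (Fin k → Fin m → Bool) : ℝ)⁻¹ * (Fintype.card (Fin k → Fin m) : ℝ)⁻¹ := by
    intro a b
    have := hE.measureReal_eq {(a, b)} Set.univ MeasurableSet.univ MeasurableSet.univ
    simpa [uniformSource_singleton] using this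
  have hXY : ∀ x y, E.μ.real {ω | E.X ω = x ∧ E.Y ω = y} = ∏ i, (P (x i, y i)).toReal := by
    intro x y
    have := hE.measureReal_eq Set.univ {fun i => (x i, y i)} MeasurableSet.univ MeasurableSet.univ
    rw [pi_toMeasure_real_singleton] at this
    simp only [Set.mem_univ, Set.mem_singleton_iff, true_and, and_true, probReal_univ, one_mul,
      mul_one, funext_iff, Prod.mk.injEq, forall_and] at this
    rw [← this]
    simp only [funext_iff]
  have hfac : E.Factors (fun x y => ∏ i, (P (x i, y i)).toReal)
      (fun a x τ => (E.μ.map E.ZA).real (S a x τ))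
      (fun b y g τ => (E.μ.map E.ZB).real (T b y g τ)) := by
    intro a b x y g τ
    have h1 := hE.measureReal_eq {(a, b)} {fun i => (x i, y i)} (hSm a x τ) (hTm b y g τ)
    rw [pi_toMeasure_real_singleton, uniformSource_singleton] at h1
    rw [mul_assoc, mul_assoc, ← h1]
    congr 1
    ext ω
    simp only [Run.view, Set.mem_ofPred_eq, Prod.mk.injEq, Set.mem_singleton_iff]
    constructor
    · rintro ⟨rfl, rfl, rfl, rfl, rfl, rfl⟩
      exact ⟨⟨rfl, rfl⟩, rfl, fun j hj => (hφ j hj ω).symm,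
        fun j hj => (hψ j hj ω).symm, (hγ ω).symm⟩
    · rintro ⟨⟨rfl, rfl⟩, h2, h3, h4⟩
      simp only [funext_iff, Prod.mk.injEq, forall_and] at h2
      obtain rfl : E.X ω = x := funext h2.1
      obtain rfl : E.Y ω = y := funext h2.2
      obtain ⟨rfl, rfl⟩ := huniq _ _ _ _ _ _ _ _ _ _ (fun j hj => (hφ j hj ω).symm) h3
        ⟨fun j hj => (hψ j hj ω).symm, (hγ ω).symm⟩ h4
      exact ⟨rfl, rfl, rfl, rfl, rfl, rfl⟩
  have hL := E.bounds_of_isSecure hm hsec hAB hfac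
    (s := fun x => ∏ i, margX P (x i)) (t := fun y => ∏ i, margY P (y i))
    (fun x y => prod_nonneg fun _ _ => ENNReal.toReal_nonneg) (fun _ _ _ => measureReal_nonneg)
    (fun _ _ _ _ => measureReal_nonneg) (fun x => prod_nonneg fun i _ => margX_nonneg P _)
    (fun y => prod_nonneg fun i _ => margY_nonneg P _)
    (fun x y h => by
      rw [hXY, prod_ne_zero_iff] at h
      exact ⟨prod_ne_zero_iff.2 fun i hi => margX_ne_zero (h i hi),
        prod_ne_zero_iff.2 fun i hi => margY_ne_zero (h i hi)⟩) ?_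
  · have hmarg : ∀ i x y, E.μ.real {ω | E.X ω i = x ∧ E.Y ω i = y} = (P (x, y)).toReal := by
      intro i x y
      have h1 := hE.measureReal_eq Set.univ {f | f i = (x, y)} MeasurableSet.univ
        MeasurableSet.univ
      have h2 := (measurePreserving_eval (fun _ : Fin n => P.toMeasure) i).measureReal_preimage
        (s := {(x, y)}) (measurableSet_singleton _).nullMeasurableSet
      have h3 : (Measure.pi fun _ : Fin n => P.toMeasure).real {f | f i = (x, y)} =
          (P (x, y)).toReal := by
        refine Eq.trans h2 ?_
        rw [measureReal_def, PMF.toMeasure_apply_singleton _ _ (measurableSet_singleton _)]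
      simpa [h3] using h1
    have h1 := sum_measureReal_log_prod E.μ E.measurable_X E.measurable_Y
      (w := fun x y => (P (x, y)).toReal) (s := fun _ => margX P) (t := fun _ => margY P)
      (fun x y h i => by
        rw [hXY, prod_ne_zero_iff] at h
        have := h i (mem_univ i)
        exact ⟨this, margX_ne_zero this, margY_ne_zero this⟩)
    have h2 := condEnt_le_sum_coord E.μ E.measurable_X E.measurable_Y
    simp only [hmarg, ← mutualInfo_mul_log, ← condEntropy_mul_log, sum_const, card_univ,
      Fintype.card_fin, nsmul_eq_mul] at h1 h2
    rw [h1] at hL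
    exact ⟨hL.1, hL.2.trans (by gcongr)⟩
  · intro a b F
    have h1 : ∀ x y, ∑ τ ∈ F, ∑ g, (E.μ.map E.ZA).real (S a x τ) *
        (E.μ.map E.ZB).real (T b y g τ) ≤ 1 := fun x y => by
      rw [← sum_product' (t := univ)]
      refine sum_measureReal_mul_le_one _ _ (F ×ˢ univ)
        (fun i => S a x i.1) (fun i => T b y i.2 i.1) (fun i => hSm _ _ _)
        (fun i => hTm _ _ _ _) fun i j z z' h1 h2 h3 h4 => ?_
      have := huniq a b x y _ _ _ _ z z' h1 h2 h3 h4
      exact Prod.ext this.1 this.2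
    calc _ = ∑ x : Fin n → 𝒳, ∑ y : Fin n → 𝒴, ((∏ i, margX P (x i)) * ∏ i, margY P (y i)) *
          ∑ τ ∈ F, ∑ g, (E.μ.map E.ZA).real (S a x τ) * (E.μ.map E.ZB).real (T b y g τ) := by
          rw [sum_comm]
          refine sum_congr rfl fun x _ => ?_
          rw [sum_comm]
          refine sum_congr rfl fun y _ => ?_
          simp only [mul_sum, mul_assoc]
      _ ≤ ∑ x : Fin n → 𝒳, ∑ y : Fin n → 𝒴, ((∏ i, margX P (x i)) * ∏ i, margY P (y i)) * 1 :=
          sum_le_sum fun x _ => sum_le_sum fun y _ => mul_le_mul_of_nonneg_left (h1 x y)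
            (mul_nonneg (prod_nonneg fun i _ => margX_nonneg P _)
              (prod_nonneg fun i _ => margY_nonneg P _))
      _ = 1 := by
          simp only [mul_one, ← mul_sum, ← sum_mul]
          rw [sum_prod_eq_one (fun _ => margX P) fun _ => sum_margX P,
            sum_prod_eq_one (fun _ => margY P) fun _ => sum_margY P, one_mul]

end

/-! ### Channel model -/

lemma jointDist_apply {𝒳 𝒴 : Type*} (PX : PMF 𝒳) (W : 𝒳 → PMF 𝒴) (x : 𝒳) (y : 𝒴) :
    jointDist PX W (x, y) = PX x * W x y := by
  classical
  rw [jointDist, PMF.bind_apply, tsum_eq_single x]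
  · rw [PMF.map_apply, tsum_eq_single y]
    · simp
    · intro y' hy'; simp [hy'.symm]
  · intro x' hx'
    rw [PMF.map_apply]
    simp [hx'.symm]

/-- Messages of index below `N'` settle the inputs sent by then (`key`), and these settle message
`N'`. Inputs sent after exactly `N` stages are covered too, since they use only messages of index
below `N`. -/
lemma channel_transcript_ext {𝒳 : Type*} {n r : ℕ} {σ : Fin n → ℕ} (hσ : Monotone σ)
    {x x' : Fin n → 𝒳} {t t' : Fin r → ℕ} {N : ℕ}
    (hx : ∀ i, (∀ l, l < i → x l = x' l) → (∀ j : Fin r, (j : ℕ) < σ i → t j = t' j) → x i = x' i)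
    (ht : ∀ j : Fin r, (j : ℕ) < N → (∀ l, σ l ≤ j → x l = x' l) →
      (∀ l : Fin r, (l : ℕ) < j → t l = t' l) → t j = t' j) :
    (∀ j : Fin r, (j : ℕ) < N → t j = t' j) ∧ ∀ l, σ l ≤ N → x l = x' l := by
  have key : ∀ N', (∀ j : Fin r, (j : ℕ) < N' → t j = t' j) → ∀ l, σ l ≤ N' → x l = x' l := by
    intro N' h l
    induction l using WellFoundedLT.induction with
    | _ l ih =>
      exact fun hl => hx l (fun l' hl' => ih l' hl' ((hσ hl'.le).trans hl))
        fun j hj => h j (hj.trans_le hl)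
  have main : ∀ N', N' ≤ N → ∀ j : Fin r, (j : ℕ) < N' → t j = t' j := by
    intro N'
    induction N' with
    | zero => intro _ j hj; omega
    | succ N' ih =>
      intro hN j hj
      have h := ih (by omega)
      rcases Nat.lt_succ_iff_lt_or_eq.1 hj with h1 | h1
      · exact h j h1
      · exact ht j (by omega) (h1 ▸ key N' h) (h1 ▸ h)
  exact ⟨main N le_rfl, key N (main N le_rfl)⟩

section

variable {𝒳 𝒴 : Type*} [Fintype 𝒳] [Fintype 𝒴]
  [MeasurableSpace 𝒳] [DiscreteMeasurableSpace 𝒳]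
  [MeasurableSpace 𝒴] [DiscreteMeasurableSpace 𝒴] {m n k : ℕ}

lemma Run.IsChannelModelWith.measureReal_eq [NeZero m]
    {E : Run (Fin m → Bool) (Fin m) 𝒳 𝒴 (Fin 1) Bool n k} {W : 𝒳 → PMF 𝒴} {σ : Fin n → ℕ}
    (hE : E.IsChannelModelWith (uniformSource m k) W σ)
    (Q : Set ((Fin k → Fin m → Bool) × (Fin k → Fin m)))
    {S : Set E.𝒵A} {T : Set E.𝒵B} (hS : MeasurableSet S) (hT : MeasurableSet T) :
    E.μ.real {ω | (E.A ω, E.B ω) ∈ Q ∧ E.ZA ω ∈ S ∧ E.ZB ω ∈ T} =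
      (uniformSource m k).real Q * ((E.μ.map E.ZA).real S * (E.μ.map E.ZB).real T) := by
  have hf : Measurable fun ω => ((E.A ω, E.B ω), E.ZA ω, E.ZB ω) :=
    (E.measurable_A.prodMk E.measurable_B).prodMk (E.measurable_ZA.prodMk E.measurable_ZB)
  have h1 := Measure.isProbabilityMeasure_map (μ := E.μ) E.measurable_ZA.aemeasurable
  have h2 := Measure.isProbabilityMeasure_map (μ := E.μ) E.measurable_ZB.aemeasurable
  rw [← measureReal_prod_prod, ← measureReal_prod_prod, ← hE.law,
    map_measureReal_apply hf (MeasurableSet.of_discrete.prod (hS.prod hT))]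
  rfl

/-- The probability that the local randomness lies in `S × T` and the channel outputs are `y`, when
`S` and `T` force the inputs to be `x` as long as the outputs are `y`. -/
lemma Run.IsChannelModelWith.measureReal_output_eq [NeZero m]
    {E : Run (Fin m → Bool) (Fin m) 𝒳 𝒴 (Fin 1) Bool n k} {W : 𝒳 → PMF 𝒴} {σ : Fin n → ℕ}
    (hE : E.IsChannelModelWith (uniformSource m k) W σ) (a : Fin k → Fin m → Bool)
    (b : Fin k → Fin m) (x : Fin n → 𝒳) (y : Fin n → 𝒴)
    {S : Set E.𝒵A} {T : Set E.𝒵B} (hS : MeasurableSet S) (hT : MeasurableSet T)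
    (hforce : ∀ ω i, E.A ω = a → E.B ω = b → E.ZA ω ∈ S → E.ZB ω ∈ T →
      (∀ l, l < i → E.Y ω l = y l) → E.X ω i = x i) :
    E.μ.real {ω | E.A ω = a ∧ E.B ω = b ∧ E.ZA ω ∈ S ∧ E.ZB ω ∈ T ∧ E.Y ω = y} =
      (uniformSource m k).real {(a, b)} * ((E.μ.map E.ZA).real S * (E.μ.map E.ZB).real T) *
        ∏ i, (W (x i) (y i)).toReal := by
  classical
  have main : ∀ i, i ≤ n → E.μ.real {ω | E.A ω = a ∧ E.B ω = b ∧ E.ZA ω ∈ S ∧ E.ZB ω ∈ T ∧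
      ∀ l : Fin n, (l : ℕ) < i → E.Y ω l = y l} =
      (uniformSource m k).real {(a, b)} * ((E.μ.map E.ZA).real S * (E.μ.map E.ZB).real T) *
        ∏ l with (l : Fin n).val < i, (W (x l) (y l)).toReal := by
    intro i
    induction i with
    | zero =>
      intro _
      rw [← hE.measureReal_eq {(a, b)} hS hT]
      simp [and_assoc]
    | succ i ih =>
      intro hi
      have hf : (univ.filter fun l : Fin n => (l : ℕ) < i + 1) =
          insert ⟨i, hi⟩ (univ.filter fun l : Fin n => (l : ℕ) < i) := by
        ext l; simp [Fin.ext_iff]; omega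
      rw [hf, prod_insert (by simp), mul_left_comm, ← ih (by omega), mul_comm]
      set i' : Fin n := ⟨i, hi⟩
      -- The event concerns past outputs and all local randomness, and forces the input to be `x
      -- i'`; the channel thus contributes exactly one factor. `S` and `T` may constrain later
      -- behaviour, as the channel law is conditional on `ZA` and `ZB` as a whole.
      have h1 := hE.channel i' (x i') (y i')
        {q | q.1 = a ∧ q.2.1 = b ∧ q.2.2.1 ∈ S ∧ q.2.2.2.1 ∈ T ∧
          q.2.2.2.2.2.1 = fun l => y l.1} ?_
      · have h2 := congrArg ENNReal.toReal h1
        rw [ENNReal.toReal_mul] at h2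
        refine Eq.trans (congrArg E.μ.real ?_) (h2.trans (congrArg (· * _) (congrArg E.μ.real ?_)))
        · ext ω
          simp only [Set.mem_ofPred_eq]
          constructor
          · rintro ⟨h1, h2, h3, h4, h5⟩
            exact ⟨⟨h1, h2, h3, h4, funext fun l => h5 l (Nat.lt_succ_of_lt l.2)⟩,
              hforce ω i' h1 h2 h3 h4 fun l hl => h5 l (Nat.lt_succ_of_lt hl),
              h5 i' (Nat.lt_succ_self i)⟩
          · rintro ⟨⟨h1, h2, h3, h4, h5⟩, _, h7⟩
            refine ⟨h1, h2, h3, h4, fun l hl => ?_⟩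
            rcases Nat.lt_succ_iff_lt_or_eq.1 hl with hl | hl
            · exact congrFun h5 ⟨l, hl⟩
            · obtain rfl : l = i' := Fin.ext hl
              exact h7
        · ext ω
          simp only [Set.mem_ofPred_eq]
          constructor
          · rintro ⟨⟨h1, h2, h3, h4, h5⟩, _⟩
            exact ⟨h1, h2, h3, h4, fun l hl => congrFun h5 ⟨l, hl⟩⟩
          · rintro ⟨h1, h2, h3, h4, h5⟩
            exact ⟨⟨h1, h2, h3, h4, funext fun l => h5 l l.2⟩,
              hforce ω i' h1 h2 h3 h4 fun l hl => h5 l hl⟩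
      · exact (measurable_fst (measurableSet_singleton a)).inter
          (((measurable_fst.comp measurable_snd) (measurableSet_singleton b)).inter
          (((measurable_fst.comp (measurable_snd.comp measurable_snd)) hS).inter
          (((measurable_fst.comp (measurable_snd.comp (measurable_snd.comp measurable_snd)))
            hT).inter ((measurable_fst.comp (measurable_snd.comp (measurable_snd.comp
            (measurable_snd.comp (measurable_snd.comp measurable_snd)))))
            (measurableSet_singleton _)))))
  have h := main n le_rfl
  simp only [Fin.is_lt, forall_const, filter_true] at h
  simpa only [funext_iff] using h

/-- The reference weights are 1 for inputs and the product of output marginals for outputs, as if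
the outputs were drawn in advance. For fixed outputs, local randomness is consistent with at most
one choice of inputs and transcript, so the mass is at most one, and the expected log ratio is the
sum of the I(X_i;Y_i). -/
theorem Run.IsChannelModelWith.bounds (hm : 2 ≤ m)
    {E : Run (Fin m → Bool) (Fin m) 𝒳 𝒴 (Fin 1) Bool n k} {W : 𝒳 → PMF 𝒴} {σ : Fin n → ℕ}
    (hE : E.IsChannelModelWith (uniformSource m k) W σ) {ε : ℝ}
    (hsec : E.IsSecure (otF m) (otG m) ε) : ∃ PX : Fin n → PMF 𝒳,
    (k * log 2 - ε * log 2 - 2 * (3 * √ε * (k * log 2) + log 2) - (ε * (k * log 2) + log 2) ≤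
      ∑ i, mutualInfo (jointDist (PX i) W) * log 2) ∧
    ((m - 1) * (k * log 2) - ε * log 2 ≤ ∑ i, condEntropy (jointDist (PX i) W) * log 2 +
      m * ((ε * (k * log 2) + log 2) + (3 * √ε * (k * log 2) + log 2))) := by
  have : NeZero m := ⟨by omega⟩
  have hpA := Measure.isProbabilityMeasure_map (μ := E.μ) E.measurable_ZA.aemeasurable
  have hpB := Measure.isProbabilityMeasure_map (μ := E.μ) E.measurable_ZB.aemeasurable
  have hU : IsProbabilityMeasure (uniformSource m k) := by unfold uniformSource; infer_instance
  have hσ := hE.monotone_schedule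
  choose φ hφm hφ using hE.alice_msg
  choose ψ hψm hψ using hE.bob_msg
  choose χ hχm hχ using hE.input
  obtain ⟨γ, hγm, hγ⟩ := hE.outputs.2
  set S : (Fin k → Fin m → Bool) → (Fin n → 𝒳) → (Fin E.r → ℕ) → Set E.𝒵A := fun a x t =>
    {z | (∀ (j : Fin E.r) (hj : Even (j : ℕ)), φ j hj (a, fun l => x l, z, fun l => t l) = t j) ∧
      ∀ i, χ i (a, fun l => x l, z, fun l => t l) = x i} with hS
  set T : (Fin k → Fin m) → (Fin n → 𝒴) → (Fin k → Bool) → (Fin E.r → ℕ) → Set E.𝒵B :=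
    fun b y g t => {z | (∀ (j : Fin E.r) (hj : Odd (j : ℕ)),
      ψ j hj (b, fun l => y l, z, fun l => t l) = t j) ∧ γ (b, y, z, t) = g} with hT
  have hSm : ∀ a x t, MeasurableSet (S a x t) := fun a x t => by
    have : S a x t = (⋂ (j : Fin E.r) (hj : Even (j : ℕ)),
        (fun z => φ j hj (a, fun l => x l, z, fun l => t l)) ⁻¹' {t j}) ∩
        ⋂ i, (fun z => χ i (a, fun l => x l, z, fun l => t l)) ⁻¹' {x i} := by ext; simp [S]
    rw [this]
    exact (MeasurableSet.iInter fun j => MeasurableSet.iInter fun hj =>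
      ((hφm j hj).comp (by fun_prop)) (measurableSet_singleton _)).inter
      (MeasurableSet.iInter fun i => ((hχm i).comp (by fun_prop)) (measurableSet_singleton _))
  have hTm : ∀ b y g t, MeasurableSet (T b y g t) := fun b y g t => by
    have : T b y g t = (⋂ (j : Fin E.r) (hj : Odd (j : ℕ)),
        (fun z => ψ j hj (b, fun l => y l, z, fun l => t l)) ⁻¹' {t j}) ∩
        (fun z => γ (b, y, z, t)) ⁻¹' {g} := by ext; simp [T]
    rw [this]
    exact (MeasurableSet.iInter fun j => MeasurableSet.iInter fun hj =>
      ((hψm j hj).comp (by fun_prop)) (measurableSet_singleton _)).inter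
      ((hγm.comp (by fun_prop)) (measurableSet_singleton _))
  -- Causality: outputs from transmissions before stage `N` determine inputs up to and including
  -- `N`. Taking `N = E.r` gives uniqueness of the run; `N = σ i` shows that earlier outputs force
  -- the `i`-th input.
  have hdet : ∀ a b x x' y y' g g' t t' z z' N, z ∈ S a x t → z ∈ S a x' t' →
      z' ∈ T b y g t → z' ∈ T b y' g' t' → (∀ l, σ l < N → y l = y' l) →
      (∀ j : Fin E.r, (j : ℕ) < N → t j = t' j) ∧ ∀ l, σ l ≤ N → x l = x' l := by
    intro a b x x' y y' g g' t t' z z' N h1 h2 h3 h4 hy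
    refine channel_transcript_ext hσ (fun i hl hj => ?_) fun j hj hl hj' => ?_
    · rw [← h1.2 i, ← h2.2 i, show (fun l : {l : Fin n // l < i} => x l) = fun l => x' l.1 from
        funext fun l => hl l l.2, show (fun l : {j : Fin E.r // (j : ℕ) < σ i} => t l) =
        fun l => t' l.1 from funext fun l => hj l l.2]
    · have e1 : (fun l : {l : Fin E.r // (l : ℕ) < j} => t l) = fun l => t' l.1 :=
        funext fun l => hj' l l.2
      rcases Nat.even_or_odd (j : ℕ) with he | ho
      · rw [← h1.1 j he, ← h2.1 j he, e1, show (fun l : {l : Fin n // σ l ≤ j} => x l) =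
          fun l => x' l.1 from funext fun l => hl l l.2]
      · rw [← h3.1 j ho, ← h4.1 j ho, e1, show (fun l : {l : Fin n // σ l ≤ j} => y l) =
          fun l => y' l.1 from funext fun l => hy l (l.2.trans_lt hj)]
  have huniq : ∀ a b x x' y g g' t t' z z', z ∈ S a x t → z ∈ S a x' t' → z' ∈ T b y g t →
      z' ∈ T b y g' t' → t = t' ∧ x = x' ∧ g = g' := by
    intro a b x x' y g g' t t' z z' h1 h2 h3 h4
    obtain ⟨e1, e2⟩ := hdet a b x x' y y g g' t t' z z' E.r h1 h2 h3 h4 fun _ _ => rfl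
    obtain rfl : t = t' := funext fun j => e1 j j.2
    exact ⟨rfl, funext fun l => e2 l (hE.schedule_le l), h3.2.symm.trans h4.2⟩
  have hrunS : ∀ ω, E.ZA ω ∈ S (E.A ω) (E.X ω) (E.M ω) := fun ω =>
    ⟨fun j hj => (hφ j hj ω).symm, fun i => (hχ i ω).symm⟩
  have hrunT : ∀ ω, E.ZB ω ∈ T (E.B ω) (E.Y ω) (E.Ghat ω) (E.M ω) := fun ω =>
    ⟨fun j hj => (hψ j hj ω).symm, (hγ ω).symm⟩
  have hAB : ∀ a b, E.μ.real {ω | E.A ω = a ∧ E.B ω = b} =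
      (Fintype.card (Fin k → Fin m → Bool) : ℝ)⁻¹ * (Fintype.card (Fin k → Fin m) : ℝ)⁻¹ := by
    intro a b
    have := hE.measureReal_eq {(a, b)} MeasurableSet.univ MeasurableSet.univ
    simpa [uniformSource_singleton] using this
  have hfac : E.Factors (fun x y => ∏ i, (W (x i) (y i)).toReal)
      (fun a x t => (E.μ.map E.ZA).real (S a x t))
      (fun b y g t => (E.μ.map E.ZB).real (T b y g t)) := by
    intro a b x y g t
    have h1 := hE.measureReal_output_eq a b x y (hSm a x t) (hTm b y g t) ?_
    · rw [uniformSource_singleton] at h1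
      rw [mul_assoc, mul_right_comm, ← h1]
      congr 1
      ext ω
      simp only [Run.view, Set.mem_ofPred_eq, Prod.mk.injEq]
      constructor
      · rintro ⟨rfl, rfl, rfl, rfl, rfl, rfl⟩
        exact ⟨rfl, rfl, hrunS ω, hrunT ω, rfl⟩
      · rintro ⟨rfl, rfl, h2, h3, rfl⟩
        obtain ⟨rfl, rfl, rfl⟩ := huniq _ _ _ _ _ _ _ _ _ _ _ (hrunS ω) h2 (hrunT ω) h3
        exact ⟨rfl, rfl, rfl, rfl, rfl, rfl⟩
    · rintro ω i rfl rfl h2 h3 hy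
      refine (hdet _ _ _ _ _ _ _ _ _ _ _ _ (σ i) (hrunS ω) h2 (hrunT ω) h3
        fun l hl => hy l (lt_of_not_ge fun h => (hσ h).not_gt hl)).2 i le_rfl
  have hXm : ∀ i, Measurable fun ω => E.X ω i := fun i =>
    (measurable_pi_apply i).comp E.measurable_X
  have hYm : ∀ i, Measurable fun ω => E.Y ω i := fun i =>
    (measurable_pi_apply i).comp E.measurable_Y
  have hpX := fun i => Measure.isProbabilityMeasure_map (μ := E.μ) (hXm i).aemeasurable
  set PX : Fin n → PMF 𝒳 := fun i => (E.μ.map fun ω => E.X ω i).toPMF with hPX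
  have hJ : ∀ i x y, (jointDist (PX i) W (x, y)).toReal =
      E.μ.real {ω | E.X ω i = x ∧ E.Y ω i = y} := by
    intro i x y
    rw [jointDist_apply, measureReal_def]
    have := hE.channel i x y Set.univ MeasurableSet.univ
    simp only [Set.mem_univ, true_and] at this
    rw [this, hPX, Measure.toPMF_apply, Measure.map_apply (hXm i) (measurableSet_singleton _)]
    rfl
  have hmY : ∀ i y, margY (jointDist (PX i) W) y = E.μ.real {ω | E.Y ω i = y} := by
    intro i y
    have hm' := (hXm i).prodMk (hYm i)
    have := Measure.isProbabilityMeasure_map (μ := E.μ) hm'.aemeasurable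
    have h1 := sum_measureReal_and_left (E.μ.map fun ω => (E.X ω i, E.Y ω i))
      (fun z => z.2 = y) Prod.fst
    simp only [map_measureReal_apply hm' MeasurableSet.of_discrete] at h1
    simp only [margY, hJ]
    exact h1
  have hmX : ∀ i x, margX (jointDist (PX i) W) x = (PX i x).toReal := by
    intro i x
    simp only [margX, jointDist_apply, ENNReal.toReal_mul, ← mul_sum, sum_toReal_pmf, mul_one]
  have hJne : ∀ x y, E.μ.real {ω | E.X ω = x ∧ E.Y ω = y} ≠ 0 → ∀ i,
      (jointDist (PX i) W (x i, y i)).toReal ≠ 0 := fun x y h i h0 => h <| by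
    rw [hJ] at h0
    exact le_antisymm (h0 ▸ measureReal_mono fun ω hω => ⟨congrFun hω.1 i, congrFun hω.2 i⟩)
      measureReal_nonneg
  have hWne : ∀ i x y, (jointDist (PX i) W (x, y)).toReal ≠ 0 →
      (PX i x).toReal ≠ 0 ∧ (W x y).toReal ≠ 0 := fun i x y h => by
    rwa [jointDist_apply, ENNReal.toReal_mul, mul_ne_zero_iff] at h
  refine ⟨PX, ?_⟩
  have hL := E.bounds_of_isSecure hm hsec hAB hfac
    (s := fun x => ∏ i : Fin n, (1 : ℝ)) (t := fun y => ∏ i, margY (jointDist (PX i) W) (y i))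
    (fun x y => prod_nonneg fun _ _ => ENNReal.toReal_nonneg) (fun _ _ _ => measureReal_nonneg)
    (fun _ _ _ _ => measureReal_nonneg) (fun x => prod_nonneg fun i _ => zero_le_one)
    (fun y => prod_nonneg fun i _ => margY_nonneg _ _)
    (fun x y h => ⟨by simp, prod_ne_zero_iff.2 fun i _ => margY_ne_zero (hJne x y h i)⟩) ?_
  · have h1 := sum_measureReal_log_prod E.μ E.measurable_X E.measurable_Y
      (w := fun x y => (W x y).toReal) (s := fun _ _ => 1)
      (t := fun i => margY (jointDist (PX i) W)) (fun x y h i =>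
        ⟨(hWne i _ _ (hJne x y h i)).2, one_ne_zero, margY_ne_zero (hJne x y h i)⟩)
    have h2 := condEnt_le_sum_coord E.μ E.measurable_X E.measurable_Y
    simp only [← hJ, ← condEntropy_mul_log] at h2
    have h3 : ∀ i, ∑ x, ∑ y, E.μ.real {ω | E.X ω i = x ∧ E.Y ω i = y} * (log (W x y).toReal -
        log 1 - log (margY (jointDist (PX i) W) y)) = mutualInfo (jointDist (PX i) W) * log 2 := by
      intro i
      rw [mutualInfo_mul_log]
      refine sum_congr rfl fun x _ => sum_congr rfl fun y _ => ?_
      rw [← hJ]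
      by_cases h0 : (jointDist (PX i) W (x, y)).toReal = 0
      · simp [h0]
      obtain ⟨e1, e2⟩ := hWne i x y h0
      have e3 : log (jointDist (PX i) W (x, y)).toReal =
          log (PX i x).toReal + log (W x y).toReal := by
        rw [jointDist_apply, ENNReal.toReal_mul, log_mul e1 e2]
      rw [e3, hmX, log_one]
      ring
    simp only [h3] at h1
    rw [h1] at hL
    exact ⟨hL.1, hL.2.trans (by gcongr)⟩
  · intro a b F
    have h1 : ∀ y, ∑ t ∈ F, ∑ x, ∑ g, (E.μ.map E.ZA).real (S a x t) *
        (E.μ.map E.ZB).real (T b y g t) ≤ 1 := fun y => by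
      have := sum_measureReal_mul_le_one (E.μ.map E.ZA) (E.μ.map E.ZB)
        (F ×ˢ (univ : Finset ((Fin n → 𝒳) × (Fin k → Bool))))
        (fun i => S a i.2.1 i.1) (fun i => T b y i.2.2 i.1) (fun i => hSm _ _ _)
        (fun i => hTm _ _ _ _) fun i j z z' h1 h2 h3 h4 => by
          obtain ⟨e1, e2, e3⟩ := huniq a b _ _ y _ _ _ _ z z' h1 h2 h3 h4
          exact Prod.ext e1 (Prod.ext e2 e3)
      rw [sum_product] at this
      simpa only [Fintype.sum_prod_type] using this
    calc _ = ∑ y : Fin n → 𝒴, (∏ i, margY (jointDist (PX i) W) (y i)) *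
          ∑ t ∈ F, ∑ x, ∑ g, (E.μ.map E.ZA).real (S a x t) * (E.μ.map E.ZB).real (T b y g t) := by
          simp only [mul_sum, prod_const_one, one_mul]
          rw [sum_comm (s := (univ : Finset (Fin n → 𝒴)))]
          refine sum_congr rfl fun t _ => ?_
          rw [sum_comm]
          simp only [mul_assoc]
      _ ≤ ∑ y : Fin n → 𝒴, (∏ i, margY (jointDist (PX i) W) (y i)) * 1 :=
          sum_le_sum fun y _ => mul_le_mul_of_nonneg_left (h1 y)
            (prod_nonneg fun i _ => margY_nonneg _ _)
      _ = 1 := by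
          simp only [mul_one]
          exact sum_prod_eq_one _ fun i => sum_margY _

end

/-! ### Optimization over channel inputs and passage to the limit -/

section

variable {𝒳 𝒴 : Type*} [Fintype 𝒳] [Fintype 𝒴]

lemma mutualInfo_jointDist (PX : PMF 𝒳) (W : 𝒳 → PMF 𝒴) :
    mutualInfo (jointDist PX W) * log 2 = ent (fun y => ∑ x, (PX x).toReal * (W x y).toReal) -
      ∑ x, (PX x).toReal * ent fun y => (W x y).toReal := by
  rw [mutualInfo_mul_log_eq_ent]
  simp only [jointDist_apply, ENNReal.toReal_mul, ent_smul]

lemma condEntropy_jointDist (PX : PMF 𝒳) (W : 𝒳 → PMF 𝒴) :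
    condEntropy (jointDist PX W) * log 2 =
      ∑ y, ent fun x => (PX x).toReal * (W x y).toReal := by
  rw [condEntropy_mul_log]
  simp only [jointDist_apply, ENNReal.toReal_mul]

lemma exists_pmf_toReal_eq {p : 𝒳 → ℝ} (hp : ∀ x, 0 ≤ p x) (hp1 : ∑ x, p x = 1) :
    ∃ PX : PMF 𝒳, ∀ x, (PX x).toReal = p x :=
  ⟨PMF.ofFintype (fun x => ENNReal.ofReal (p x)) (by
    rw [← ENNReal.ofReal_sum_of_nonneg fun x _ => hp x, hp1, ENNReal.ofReal_one]),
    fun x => by rw [PMF.ofFintype_apply, ENNReal.toReal_ofReal (hp x)]⟩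

/-- Concavity of mutual information and of conditional entropy in the channel input. -/
lemma exists_average_input {n : ℕ} (hn : 0 < n) (PX : Fin n → PMF 𝒳) (W : 𝒳 → PMF 𝒴) :
    ∃ QX : PMF 𝒳,
      ∑ i, mutualInfo (jointDist (PX i) W) * log 2 ≤ n * (mutualInfo (jointDist QX W) * log 2) ∧
      ∑ i, condEntropy (jointDist (PX i) W) * log 2 ≤
        n * (condEntropy (jointDist QX W) * log 2) := by
  have hn' : (n : ℝ) ≠ 0 := by positivity
  obtain ⟨QX, hQ⟩ := exists_pmf_toReal_eq (p := fun x => (n : ℝ)⁻¹ * ∑ i, (PX i x).toReal)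
    (fun x => by positivity) (by
      rw [← mul_sum, sum_comm]
      simp [sum_toReal_pmf, hn'])
  have hQ' : ∀ x, (n : ℝ) * (QX x).toReal = ∑ i, (PX i x).toReal := fun x => by
    rw [hQ, mul_inv_cancel_left₀ hn']
  refine ⟨QX, ?_, ?_⟩
  · simp only [mutualInfo_jointDist]
    rw [sum_sub_distrib, mul_sub, ← ent_smul]
    -- The output entropy is concave in the input law, while the conditional term is linear.
    refine sub_le_sub ?_ (le_of_eq ?_)
    · refine (sum_ent_le univ fun i y => sum_nonneg fun x _ => by positivity).trans_eq ?_
      congr 1 with y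
      rw [sum_comm, mul_sum]
      exact sum_congr rfl fun x _ => by rw [← sum_mul, ← hQ', mul_assoc]
    · rw [sum_comm, mul_sum]
      exact sum_congr rfl fun x _ => by rw [← sum_mul, ← hQ', mul_assoc]
  · simp only [condEntropy_jointDist]
    rw [sum_comm, mul_sum]
    refine sum_le_sum fun y _ => ?_
    rw [← ent_smul]
    refine (sum_ent_le univ fun i x => by positivity).trans_eq ?_
    congr 1 with x
    rw [← sum_mul, ← hQ', mul_assoc]

/-- In terms of `ent` the bound is continuous on the compact simplex; since `negMulLog` is
continuous at 0, the boundary needs no separate care. -/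
lemma exists_otBound_max [Nonempty 𝒳] (m : ℕ) (W : 𝒳 → PMF 𝒴) :
    ∃ PX : PMF 𝒳, ∀ PX' : PMF 𝒳, otBound m (jointDist PX' W) ≤ otBound m (jointDist PX W) := by
  classical
  have hlog : log 2 ≠ 0 := (log_pos one_lt_two).ne'
  set f : (𝒳 → ℝ) → ℝ := fun p =>
    min ((ent (fun y => ∑ x, p x * (W x y).toReal) -
      ∑ x, p x * ent fun y => (W x y).toReal) / log 2)
      ((∑ y, ent fun x => p x * (W x y).toReal) / log 2 / (m - 1)) with hf
  have hfP : ∀ PX : PMF 𝒳, otBound m (jointDist PX W) = f fun x => (PX x).toReal := fun PX => by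
    simp only [hf, ← mutualInfo_jointDist, ← condEntropy_jointDist, mul_div_cancel_right₀ _ hlog]
    rfl
  have hcont : Continuous f := by
    simp only [hf, ent]
    fun_prop
  obtain ⟨p, hp, hmax⟩ := (isCompact_stdSimplex ℝ 𝒳).exists_isMaxOn
    ⟨_, single_mem_stdSimplex ℝ (Classical.arbitrary 𝒳)⟩ hcont.continuousOn
  obtain ⟨PX, hPX⟩ := exists_pmf_toReal_eq hp.1 hp.2
  refine ⟨PX, fun PX' => ?_⟩
  rw [hfP, hfP, funext hPX]
  exact hmax ⟨fun x => ENNReal.toReal_nonneg, sum_toReal_pmf PX'⟩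

end

/-- The constants 8 and 5 are dictated by the second bound: with ε ≤ √ε its error is at most m (4 √ε
k + 2), and m ≤ 2 (m - 1) makes this 8 √ε k + 4 after division by m - 1; the remaining ε contributes
at most 1. -/
lemma rate_le_min {m k : ℕ} (hm : 2 ≤ m) {ε I H : ℝ} (hε : 0 < ε) (hε1 : ε ≤ 1)
    (h1 : k * log 2 - ε * log 2 - 2 * (3 * √ε * (k * log 2) + log 2) -
      (ε * (k * log 2) + log 2) ≤ I * log 2)
    (h2 : (m - 1) * (k * log 2) - ε * log 2 ≤ H * log 2 +
      m * ((ε * (k * log 2) + log 2) + (3 * √ε * (k * log 2) + log 2))) :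
    k * (1 - 8 * √ε) - 5 ≤ min I (H / (m - 1)) := by
  have hlog : 0 < log 2 := log_pos one_lt_two
  have h1' : k - ε - 2 * (3 * √ε * k + 1) - (ε * k + 1) ≤ I := by
    refine le_of_mul_le_mul_right ?_ hlog
    linarith
  have h2' : (m - 1) * k - ε ≤ H + m * ((ε * k + 1) + (3 * √ε * k + 1)) := by
    refine le_of_mul_le_mul_right ?_ hlog
    linarith
  have hs : ε ≤ √ε := by
    rw [Real.le_sqrt' hε]; nlinarith
  have hk : (0 : ℝ) ≤ k := Nat.cast_nonneg k
  have hεk : ε * k ≤ √ε * k := mul_le_mul_of_nonneg_right hs hk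
  have hm' : (2 : ℝ) ≤ m := by exact_mod_cast hm
  have hsk : 0 ≤ √ε * k := by positivity
  refine le_min (by nlinarith) ?_
  rw [le_div_iff₀ (by linarith)]
  have h3 : (m : ℝ) * ((ε * k + 1) + (3 * √ε * k + 1)) ≤ 2 * (m - 1) * (4 * (√ε * k) + 2) := by
    have : (m : ℝ) ≤ 2 * (m - 1) := by linarith
    refine (mul_le_mul_of_nonneg_right this (by positivity)).trans ?_
    refine mul_le_mul_of_nonneg_left (by linarith) (by linarith)
  nlinarith

/-- For ε < 1/64 the factor 1 - 8 √ε is positive, so the lower bound for k / n may be multiplied by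
it before ε tends to 0. -/
lemma le_of_rate_bounds {R b : ℝ} (h : ∀ ε : ℝ, 0 < ε → ε < 1 / 64 → ∃ n k : ℕ, 0 < n ∧
    R - ε < (k : ℝ) / n ∧ 5 / (n : ℝ) ≤ ε ∧ k * (1 - 8 * √ε) - 5 ≤ n * b) : R ≤ b := by
  have hlim : Filter.Tendsto (fun ε : ℝ => (R - ε) * (1 - 8 * √ε) - ε) (nhdsWithin 0 (Set.Ioi 0))
      (nhds R) := by
    have : Continuous fun ε : ℝ => (R - ε) * (1 - 8 * √ε) - ε := by fun_prop
    simpa using (this.tendsto 0).mono_left nhdsWithin_le_nhds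
  refine le_of_tendsto hlim ?_
  filter_upwards [Ioo_mem_nhdsGT (show (0 : ℝ) < 1 / 64 by norm_num)] with ε hε
  obtain ⟨n, k, hn, h1, h2, h3⟩ := h ε hε.1 hε.2
  have hn' : (0 : ℝ) < n := by exact_mod_cast hn
  have hs : √ε ≤ 1 / 8 := by
    rw [Real.sqrt_le_left (by norm_num)]; linarith [hε.2]
  have h4 : (R - ε) * (1 - 8 * √ε) ≤ (k : ℝ) / n * (1 - 8 * √ε) :=
    mul_le_mul_of_nonneg_right h1.le (by linarith)
  have h5 : (k : ℝ) / n * (1 - 8 * √ε) - 5 / n ≤ b := by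
    rw [div_mul_eq_mul_div, ← sub_div, div_le_iff₀ hn', mul_comm b]
    exact h3
  linarith

section

variable {𝒳 𝒴 : Type*} [Fintype 𝒳] [Fintype 𝒴] [MeasurableSpace 𝒳] [DiscreteMeasurableSpace 𝒳]
  [MeasurableSpace 𝒴] [DiscreteMeasurableSpace 𝒴] {m : ℕ}

lemma IsAchievableRate.le_of_bound {b R : ℝ}
    {acc : ∀ n k : ℕ, Run (Fin m → Bool) (Fin m) 𝒳 𝒴 (Fin 1) Bool n k → Prop}
    (hR : IsAchievableRate (otF m) (otG m) acc R)
    (h : ∀ n k (E : Run (Fin m → Bool) (Fin m) 𝒳 𝒴 (Fin 1) Bool n k) (ε : ℝ), 0 < n → 0 < ε →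
      ε ≤ 1 → acc n k E → E.IsSecure (otF m) (otG m) ε → k * (1 - 8 * √ε) - 5 ≤ n * b) :
    R ≤ b := by
  refine le_of_rate_bounds fun ε hε hε1 => ?_
  obtain ⟨N, hN⟩ := hR.2 ε hε
  obtain ⟨N', hN'⟩ := exists_nat_ge (5 / ε)
  -- `N'` makes 5 / n ≤ ε, and the 1 excludes division by n = 0.
  set n := max N (max N' 1)
  obtain ⟨k, E, hacc, hk, hsec⟩ := hN n (le_max_left _ _)
  have hn : 0 < n := lt_of_lt_of_le one_pos ((le_max_right _ _).trans (le_max_right _ _))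
  have hn' : (0 : ℝ) < n := by exact_mod_cast hn
  have hnN : (N' : ℝ) ≤ n := by exact_mod_cast (le_max_left _ _).trans (le_max_right _ _)
  refine ⟨n, k, hn, hk, ?_, h n k E ε hn hε (by linarith) hacc hsec⟩
  rw [div_le_iff₀ hn']
  rw [div_le_iff₀ hε] at hN'
  nlinarith

theorem otSourceCapacity_le (hm : 2 ≤ m) (P : PMF (𝒳 × 𝒴)) :
    otSourceCapacity m P ≤ ENNReal.ofReal (otBound m P) := by
  refine iSup₂_le fun R hR => ENNReal.ofReal_le_ofReal ?_
  refine hR.le_of_bound fun n k E ε hn hε hε1 hE hsec => ?_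
  obtain ⟨h1, h2⟩ := hE.bounds hm hsec
  rw [← mul_assoc (n : ℝ)] at h1 h2
  have := rate_le_min hm hε hε1 h1 h2
  rwa [mul_div_assoc, ← mul_min_of_nonneg _ _ (Nat.cast_nonneg n)] at this

theorem otChannelCapacity_le (hm : 2 ≤ m) {W : 𝒳 → PMF 𝒴} {b : ℝ}
    (hb : ∀ PX : PMF 𝒳, otBound m (jointDist PX W) ≤ b) :
    otChannelCapacity m W ≤ ENNReal.ofReal b := by
  refine iSup₂_le fun R hR => ENNReal.ofReal_le_ofReal ?_
  refine hR.le_of_bound fun n k E ε hn hε hε1 hE hsec => ?_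
  obtain ⟨σ, hσ⟩ := hE
  obtain ⟨PX, h1, h2⟩ := hσ.bounds hm hsec
  obtain ⟨QX, h3, h4⟩ := exists_average_input hn PX W
  have h5 := rate_le_min (I := n * mutualInfo (jointDist QX W))
    (H := n * condEntropy (jointDist QX W)) hm hε hε1
    (h1.trans (h3.trans_eq (mul_assoc _ _ _).symm)) (by linarith)
  rw [mul_div_assoc, ← mul_min_of_nonneg _ _ (Nat.cast_nonneg n)] at h5
  exact h5.trans (mul_le_mul_of_nonneg_left (hb QX) (Nat.cast_nonneg n))

end

end SFC

theorem theorem2 {𝒳 𝒴 : Type*} [Fintype 𝒳] [Fintype 𝒴] [Nonempty 𝒳]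
    [MeasurableSpace 𝒳] [DiscreteMeasurableSpace 𝒳]
    [MeasurableSpace 𝒴] [DiscreteMeasurableSpace 𝒴] (m : ℕ) (hm : 2 ≤ m) :
    (∀ P : PMF (𝒳 × 𝒴),
      SFC.otSourceCapacity m P ≤ ENNReal.ofReal (SFC.otBound m P)) ∧
    (∀ W : 𝒳 → PMF 𝒴, ∃ PX : PMF 𝒳,
      (∀ PX' : PMF 𝒳, SFC.otBound m (SFC.jointDist PX' W) ≤ SFC.otBound m (SFC.jointDist PX W)) ∧
      SFC.otChannelCapacity m W ≤ ENNReal.ofReal (SFC.otBound m (SFC.jointDist PX W))) := by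
  refine ⟨fun P => SFC.otSourceCapacity_le hm P, fun W => ?_⟩
  obtain ⟨PX, hPX⟩ := SFC.exists_otBound_max m W
  exact ⟨PX, hPX, SFC.otChannelCapacity_le hm hPX⟩
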